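/- Let $\Omega=\{0,1\}^{\mathbb N}$, for a finite binary word $x$ let $x\Omega$ be the set of sequences beginning with $x$, and for $p\in[0,1]$ let $B_p$ be the Bernoulli measure on $\Omega$ (independent digits, each equal to $1$ with probability $p$). A function $t\colon\Omega\to[0,\infty]$ is lower semicomputable (relative to an oracle) if there is an algorithm (with this oracle) that, given a rational $r$, enumerates words $x$ such that $\{\omega: r<t(\omega)\}$ is the union of the sets $x\Omega$. A function $t\colon\Omega\times[0,1]\to[0,\infty]$ is lower semicomputable if there is an algorithm that, given a rational $r$, enumerates rectangles $x\Omega\times((u,v)\cap[0,1])$ with $u,v$ rational whose union is $\{(\omega,p): r<t(\omega,p)\}$. An oracle for $p\in[0,1]$ returns, given $i$, the $i$-th digit of a binary expansion $0.b_0b_1b_2\ldots$ of $p$ (any of the expansions may be used if there are two). A Bernoulli test is a lower semicomputable $t\colon\Omega\to[0,\infty]$ with $\int t\,dB_p\le1$ for all $p\in[0,1]$. A uniform Bernoulli test is a lower semicomputable $t\colon\Omega\times[0,1]\to[0,\infty]$ with $\int t(\omega,p)\,dB_p(\omega)\le 1$ for all $p\in[0,1]$. For a fixed $p$, a $p$-relativized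 $B_p$-test is a function $t\colon\Omega\to[0,\infty]$ that is lower semicomputable relative to the oracle for $p$ and satisfies $\int t\,dB_p\le 1$. A test $u$ of one of these kinds is universal if for each test $t$ of the same kind there is a finite constant $c$ with $t\le c\,u$ everywhere. A sequence is Bernoulli if a universal Bernoulli test is finite on it. A sequence is random with respect to $B_p$ with oracle $p$ if every $p$-relativized $B_p$-test is finite on it. It is Martin-Löf random with respect to $B_p$ with oracle $p$ if it lies outside $\bigcap_i U_i$ for every sequence of sets $U_i$ that are unions of sets $x\Omega$ enumerated, uniformly in $i$, with the oracle for $p$ and satisfy $B_p(U_i)\le 2^{-i}$. Then: (1) There exist a universal Bernoulli test, a universal uniform Bernoulli test and, for each $p\in[0,1]$ (and each binary expansion of $p$ as the oracle), a universal $p$-relativized $B_p$-test. (2) If $t$ is a universal uniform Bernoulli test and $t_{\mathcal B}$ a universal Bernoulli test, then $\inf_{p\in[0,1]}t(\omega,p)$ and $t_{\mathcal B}(\omega)$ coincide up to a multiplicative constant: each is at most a finite constant, not depending on $\omega$, times the other. (3) If $t$ is a universal uniform Bernoulli test, then for each fixed $p\in[0,1]$ the function $\omega\mapsto t(\omega,p)$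 coincides, up to a multiplicative constant not depending on $\omega$ (it may depend on $p$), with each universal $p$-relativized $B_p$-test. (4) For each universal Bernoulli test $t_{\mathcal B}$ and each $\omega\in\Omega$: $t_{\mathcal B}(\omega)<\infty$ (that is, $\omega$ is Bernoulli) if and only if for some $p\in[0,1]$ the sequence $\omega$ is Martin-Löf random with respect to $B_p$ with oracle $p$, and also if and only if for some $p\in[0,1]$ it is random with respect to $B_p$ with oracle $p$. This holds whichever binary expansion of each $p$ serves as the oracle. -/

import Mathlib

open MeasureTheory ProbabilityTheory
open scoped ENNReal NNReal unitInterval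

namespace BernoulliTests

/-- The Cantor space `Ω` of infinite binary sequences, `true` standing for the digit `1`. -/
abbrev Omega : Type := ℕ → Bool

/-- The interval `xΩ`: all infinite sequences that begin with the binary word `x`. -/
def wordCylinder (x : List Bool) : Set Omega :=
  {ω | ∀ i : Fin x.length, ω i = x.get i}

/-- Codes of rational numbers; every rational number has codes. -/
abbrev RatCode : Type := ℕ × ℕ × ℕ

/-- The rational number `(a - b) / (c + 1)` coded by `(a, b, c)`. -/
def ratOf (r : RatCode) : ℚ := ((r.1 : ℚ) - (r.2.1 : ℚ)) / ((r.2.2 : ℚ) + 1)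

/-- The basic rectangle `xΩ × ((u, v) ∩ [0,1])` in `Ω × [0,1]`, where `u, v` are rational
(it is empty when `v ≤ u`). -/
def rectangle (a : List Bool × RatCode × RatCode) : Set (Omega × I) :=
  {z | z.1 ∈ wordCylinder a.1 ∧ (ratOf a.2.1 : ℝ) < (z.2 : ℝ) ∧ (z.2 : ℝ) < (ratOf a.2.2 : ℝ)}

/-- Recursive enumerability with oracles from `O`: the predicate is the domain of a partial
function recursive in `O`. For `O = ∅` this is `REPred`. -/
def REPredIn {α : Type} [Primcodable α] (O : Set (ℕ →. ℕ)) (P : α → Prop) : Prop :=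
  RecursiveIn O fun a => Part.assert (P a) fun _ => Part.some ()

/-- A family `U` of sets is effectively open, uniformly in the index `i` and relative to `O`:
each `U i` is a union of basic sets `base a` that can be enumerated given `i`. -/
def UniformlyEffectivelyOpen {ι α X : Type} [Primcodable ι] [Primcodable α]
    (O : Set (ℕ →. ℕ)) (base : α → Set X) (U : ι → Set X) : Prop :=
  ∃ W : ι × α → Prop, REPredIn O W ∧ ∀ i, U i = {x | ∃ a, W (i, a) ∧ x ∈ base a}

/-- Lower semicomputability, relative to `O`, of a function with values in `[0, ∞]`: the sets
`{x | r < t x}` are effectively open uniformly in the rational number `r`. -/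
def LowerSemicomputable {α X : Type} [Primcodable α] (O : Set (ℕ →. ℕ)) (base : α → Set X)
    (t : X → ℝ≥0∞) : Prop :=
  UniformlyEffectivelyOpen O base
    fun r : RatCode => {x | ((ratOf r : ℝ) : EReal) < ((t x : ℝ≥0∞) : EReal)}

/-- The Bernoulli measure `B_p` on `Ω`: independent digits, each equal to `1` with
probability `p`. -/
noncomputable def bernoulliProd (p : I) : Measure Omega :=
  Measure.infinitePi fun _ : ℕ => bernoulliMeasure true false p

/-- Randomness tests of bounded expectation with respect to `P`, relative to `O`. -/
def IsTest (O : Set (ℕ →. ℕ)) (P : Measure Omega) (t : Omega → ℝ≥0∞) : Prop :=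
  LowerSemicomputable O wordCylinder t ∧ ∫⁻ ω, t ω ∂P ≤ 1

/-- Bernoulli tests of bounded expectation. -/
def IsBernoulliTest (t : Omega → ℝ≥0∞) : Prop :=
  LowerSemicomputable ∅ wordCylinder t ∧ ∀ p : I, ∫⁻ ω, t ω ∂(bernoulliProd p) ≤ 1

/-- Uniform Bernoulli tests, functions of a sequence and a parameter `p ∈ [0,1]`. -/
def IsUniformBernoulliTest (t : Omega × I → ℝ≥0∞) : Prop :=
  LowerSemicomputable ∅ rectangle t ∧ ∀ p : I, ∫⁻ ω, t (ω, p) ∂(bernoulliProd p) ≤ 1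

/-- `f ≤ c · g` everywhere, for some finite constant `c`. -/
def DominatedBy {X : Type} (f g : X → ℝ≥0∞) : Prop :=
  ∃ c : ℝ≥0, ∀ x, f x ≤ (c : ℝ≥0∞) * g x

/-- `f` and `g` coincide up to a multiplicative constant. -/
def EqUpToConst {X : Type} (f g : X → ℝ≥0∞) : Prop :=
  DominatedBy f g ∧ DominatedBy g f

/-- `u` is universal in the class `C` of functions: it belongs to `C` and is maximal there up to
a multiplicative constant. -/
def IsUniversal {X : Type} (C : (X → ℝ≥0∞) → Prop) (u : X → ℝ≥0∞) : Prop :=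
  C u ∧ ∀ t, C t → DominatedBy t u

/-- `ω` passes every test of bounded expectation with respect to `P` relative to `O`. -/
def IsRandom (O : Set (ℕ →. ℕ)) (P : Measure Omega) (ω : Omega) : Prop :=
  ∀ t, IsTest O P t → t ω < ∞

/-- Martin-Löf tests with respect to `P`, relative to `O`. -/
def IsMartinLofTest (O : Set (ℕ →. ℕ)) (P : Measure Omega) (U : ℕ → Set Omega) : Prop :=
  UniformlyEffectivelyOpen O wordCylinder U ∧ ∀ i, P (U i) ≤ (2⁻¹ : ℝ≥0∞) ^ i

/-- `ω` passes every Martin-Löf test with respect to `P` relative to `O`. -/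
def IsMartinLofRandom (O : Set (ℕ →. ℕ)) (P : Measure Omega) (ω : Omega) : Prop :=
  ∀ U, IsMartinLofTest O P U → ω ∉ ⋂ i, U i

/-- The oracle that returns the `n`-th digit of the binary sequence `b`. -/
def digitOracle (b : ℕ → Fin 2) : Set (ℕ →. ℕ) :=
  {fun n => Part.some (b n : ℕ)}

/-- `b` is a binary expansion `p = 0.b₀b₁b₂…` of `p`. -/
def IsBinaryExpansion (p : I) (b : ℕ → Fin 2) : Prop :=
  Real.ofDigits b = (p : ℝ)

end BernoulliTests

open BernoulliTests

/-! Everything rests on one universal uniform test, obtained by trimming. A test is approximated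
from below by "pieces": a natural number as value on a product of a cylinder and a small dyadic
interval of parameters. For a finite list of pieces, a decidable inequality between natural numbers
guarantees that the maximum of the pieces has `B_p`-integral at most `2` for all `p` in a given
dyadic interval (`Bounded.lintegral_le`). Conversely, if the integral at one `p` is at most `1`, the
inequality holds on all sufficiently small dyadic intervals around `p`, by continuity
(`eventually_bounded`). The gap between `1` and `2` is what lets a decidable condition serve both
purposes. The universal test takes the pieces of all programs, each only on intervals where its
stage passes the check, with weight `2⁻¹ ^ (c + 3)` for program `c`.

Trimming is local in `p`: a program loses nothing at a parameter where its pieces are majorized by a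
function of integral at most `1`, whatever happens at other parameters
(`exists_le_mul_universalTest`). Applied at all `p`, this gives universality among uniform tests.
Applied at one `p`, it dominates every test with oracle `p`, once oracle computations are turned
into enumerations over neighborhoods of `p` (`REPredIn.exists_dyadic`). The obstacle is that
neighborhoods of a dyadic rational do not determine its digits; but then the expansion is eventually
constant, so the oracle is computable and can be dropped.

The infimum over `p` of a uniform test is lower semicomputable because `[0,1]` is compact: finitely
many rectangles certify a lower bound for all `p` at once. As a Bernoulli test is a uniform test
constant in `p`, the infimum of a universal uniform test is a universal Bernoulli test. The infimum
is finite exactly when some slice is finite, which is randomness for some `B_p` with oracle `p`.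
Martin-Löf tests and tests of bounded expectation are exchanged by Markov's inequality and by a
weighted supremum of indicators. -/

/-! ### Closure properties of recursively enumerable predicates -/

section RecursivelyEnumerable

open Encodable

variable {α β : Type} [Primcodable α] [Primcodable β]

theorem REPred.comp {P : β → Prop} {f : α → β} (hP : REPred P) (hf : Computable f) :
    REPred fun a => P (f a) :=
  Partrec.comp hP hf

theorem PrimrecPred.rePred {P : α → Prop} (hP : PrimrecPred P) : REPred P :=
  hP.computablePred.to_re

/-- Bounding the running time gives a primitive recursive approximation, increasing in the time
bound. Monotonicity lets finitely many witnesses be merged into their maximum. -/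
theorem REPred.exists_primrec {P : α → Prop} (hP : REPred P) :
    ∃ D : α → ℕ → Prop, PrimrecRel D ∧ (∀ a s t, s ≤ t → D a s → D a t) ∧
      ∀ a, P a ↔ ∃ s, D a s := by
  obtain ⟨c, hc⟩ := Nat.Partrec.Code.exists_code.1 hP
  refine ⟨fun a s => (Nat.Partrec.Code.evaln s c (encode a)).isSome, ?_, ?_, ?_⟩
  · refine Primrec₂.primrecRel (Primrec.of_eq (f := fun q : α × ℕ =>
      (Nat.Partrec.Code.evaln q.2 c (encode q.1)).isSome) ?_ ?_)
    · exact Primrec.option_isSome.comp (Nat.Partrec.Code.primrec_evaln.comp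
        (Primrec.pair (Primrec.pair Primrec.snd (Primrec.const c))
          (Primrec.encode.comp Primrec.fst)))
    · intro q; simp
  · intro a s t hst h
    obtain ⟨y, hy⟩ := Option.isSome_iff_exists.1 h
    exact Option.isSome_iff_exists.2 ⟨y, Nat.Partrec.Code.evaln_mono hst hy⟩
  · intro a
    have h1 : P a ↔ (Nat.Partrec.Code.eval c (encode a)).Dom := by
      rw [hc]
      simp only [encodek, Part.coe_some, Part.bind_some]
      constructor
      · intro h; exact ⟨h, trivial⟩
      · rintro ⟨h, -⟩; exact h
    rw [h1, Part.dom_iff_mem]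
    simp only [Nat.Partrec.Code.evaln_complete, Option.isSome_iff_exists, Option.mem_def]
    exact exists_comm

theorem PrimrecRel.exists_rePred {D : α → ℕ → Prop} (hD : PrimrecRel D) :
    REPred fun a => ∃ s, D a s := by
  classical
  have h : Partrec (fun a ↦ Nat.rfind fun n => Part.some (decide (D a n))) :=
    Partrec.rfind (Primrec.to_comp hD.decide).partrec
  refine h.dom_re.of_eq fun a => ?_
  refine Nat.rfind_dom'.trans ?_
  simp

theorem REPred.exists {P : α → β → Prop} (hP : REPred fun q : α × β => P q.1 q.2) :
    REPred fun a => ∃ b, P a b := by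
  obtain ⟨D, hD, -, hPD⟩ := hP.exists_primrec
  -- Dovetailing: `n` codes a pair of a candidate `b` and a time bound.
  have h : PrimrecRel fun (a : α) (n : ℕ) =>
      ∃ b ∈ (decode (α := β) n.unpair.1).toList, D (a, b) n.unpair.2 := by
    have h1 : PrimrecRel fun (b : β) (q : α × ℕ) => D (q.1, b) q.2.unpair.2 :=
      hD.comp (Primrec.pair (Primrec.fst.comp Primrec.snd) Primrec.fst)
        (Primrec.snd.comp (Primrec.unpair.comp (Primrec.snd.comp Primrec.snd)))
    exact h1.exists_mem_list.comp
      (Primrec.optionToList.comp (Primrec.decode.comp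
        (Primrec.fst.comp (Primrec.unpair.comp Primrec.snd)))) Primrec.id
  refine h.exists_rePred.of_eq fun a => ?_
  simp only [hPD (a, _), Option.mem_toList]
  constructor
  · rintro ⟨n, b, -, h⟩; exact ⟨b, _, h⟩
  · rintro ⟨b, s, h⟩; exact ⟨Nat.pair (encode b) s, b, by simp, by simpa using h⟩

theorem REPred.and {P Q : α → Prop} (hP : REPred P) (hQ : REPred Q) :
    REPred fun a => P a ∧ Q a := by
  obtain ⟨D, hD, hDm, hPD⟩ := hP.exists_primrec
  obtain ⟨E, hE, hEm, hQE⟩ := hQ.exists_primrec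
  refine (PrimrecRel.exists_rePred (D := fun a s => D a s ∧ E a s)
    (PrimrecPred.and hD hE)).of_eq fun a => ?_
  rw [hPD, hQE]
  constructor
  · rintro ⟨s, h, h'⟩; exact ⟨⟨s, h⟩, ⟨s, h'⟩⟩
  · rintro ⟨⟨s, h⟩, ⟨t, h'⟩⟩
    exact ⟨max s t, hDm _ _ _ (le_max_left _ _) h, hEm _ _ _ (le_max_right _ _) h'⟩

theorem REPred.or {P Q : α → Prop} (hP : REPred P) (hQ : REPred Q) :
    REPred fun a => P a ∨ Q a := by
  obtain ⟨D, hD, hDm, hPD⟩ := hP.exists_primrec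
  obtain ⟨E, hE, hEm, hQE⟩ := hQ.exists_primrec
  refine (PrimrecRel.exists_rePred (D := fun a s => D a s ∨ E a s)
    (PrimrecPred.or hD hE)).of_eq fun a => ?_
  rw [hPD, hQE, exists_or]

theorem REPred.forall_lt {P : α → ℕ → Prop} (hP : REPred fun q : α × ℕ => P q.1 q.2)
    {f : α → ℕ} (hf : Primrec f) : REPred fun a => ∀ n < f a, P a n := by
  obtain ⟨D, hD, hDm, hPD⟩ := hP.exists_primrec
  have h : PrimrecRel fun (a : α) (s : ℕ) => ∀ n < f a, D (a, n) s := by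
    have h1 : PrimrecRel fun (n : ℕ) (q : α × ℕ) => D (q.1, n) q.2 :=
      hD.comp (Primrec.pair (Primrec.fst.comp Primrec.snd) Primrec.fst)
        (Primrec.snd.comp Primrec.snd)
    exact (h1.forall_mem_list.comp (Primrec.list_range.comp (hf.comp Primrec.fst))
      Primrec.id).of_eq fun q => by simp
  refine h.exists_rePred.of_eq fun a => ?_
  simp only [hPD (a, _)]
  constructor
  · rintro ⟨s, h⟩ n hn; exact ⟨s, h n hn⟩
  · intro h
    choose! g hg using h
    exact ⟨(Finset.range (f a)).sup g, fun n hn =>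
      hDm _ _ _ (Finset.le_sup (f := g) (Finset.mem_range.2 hn)) (hg n hn)⟩

end RecursivelyEnumerable

/-! ### Oracle computations and finite prefixes of the oracle -/

namespace BernoulliTests

open Encodable

variable {α : Type} [Primcodable α]

theorem rePredIn_empty {P : α → Prop} : REPredIn ∅ P ↔ REPred P :=
  recursiveIn_empty_iff

/-- The first `k` terms of a sequence. -/
def digitPrefix {β : Type} (b : ℕ → β) (k : ℕ) : List β := (List.range k).map b

theorem length_digitPrefix {β : Type} (b : ℕ → β) (k : ℕ) : (digitPrefix b k).length = k := by
  simp [digitPrefix]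

theorem digitPrefix_succ {β : Type} (b : ℕ → β) (k : ℕ) :
    digitPrefix b (k + 1) = digitPrefix b k ++ [b k] := by
  simp [digitPrefix, List.range_succ]

theorem getElem?_digitPrefix {β : Type} (b : ℕ → β) (k n : ℕ) :
    (digitPrefix b k)[n]? = if n < k then some (b n) else none := by
  simp [digitPrefix, List.getElem?_map]
  split_ifs with h
  · simp [h]
  · simp; omega

/-- The use principle: a computation with the oracle `b` depends on a finite prefix of `b`. -/
theorem exists_primrec_approx {b : ℕ → Fin 2} {f : ℕ →. ℕ}
    (hf : Nat.RecursiveIn (digitOracle b) f) :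
    ∃ F : List (Fin 2) → ℕ → Option ℕ, Primrec₂ F ∧
      (∀ k l n y, k ≤ l → F (digitPrefix b k) n = some y → F (digitPrefix b l) n = some y) ∧
      ∀ n y, y ∈ f n ↔ ∃ k, F (digitPrefix b k) n = some y := by
  -- The length of the prefix bounds both the oracle queries and the unbounded searches, so every
  -- approximation is primitive recursive and stable under longer prefixes.
  induction hf with
  | zero => exact ⟨fun _ _ => some 0, Primrec₂.const _, fun _ _ _ _ _ h => h, fun n y => by
      show y ∈ Part.some 0 ↔ _
      simp [eq_comm]⟩
  | succ => exact ⟨fun _ n => some (n + 1),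
      Primrec.option_some.comp (Primrec.succ.comp Primrec.snd),
      fun _ _ _ _ _ h => h, fun n y => by simp [eq_comm]⟩
  | left => exact ⟨fun _ n => some n.unpair.1, Primrec.option_some.comp
      (Primrec.fst.comp (Primrec.unpair.comp Primrec.snd)),
      fun _ _ _ _ _ h => h, fun n y => by simp [eq_comm]⟩
  | right => exact ⟨fun _ n => some n.unpair.2, Primrec.option_some.comp
      (Primrec.snd.comp (Primrec.unpair.comp Primrec.snd)),
      fun _ _ _ _ _ h => h, fun n y => by simp [eq_comm]⟩
  | oracle g hg =>
    obtain rfl : g = _ := hg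
    refine ⟨fun τ n => Option.map (fun d : Fin 2 => d.val) τ[n]?,
      Primrec.option_map Primrec.list_getElem? (Primrec.fin_val.comp₂ Primrec₂.right), ?_, ?_⟩
    · intro k l n y hkl
      simp only [getElem?_digitPrefix]
      split_ifs with h1 h2 h2
      · exact id
      · omega
      · simp
      · simp
    · intro n y
      simp only [getElem?_digitPrefix, Part.mem_some_iff]
      constructor
      · rintro rfl; exact ⟨n + 1, by simp⟩
      · rintro ⟨k, hk⟩
        split_ifs at hk with h
        · simpa using hk.symm
        · simp at hk
  | @pair f h _ _ ihf ihh =>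
    obtain ⟨F, hF, hFm, hFf⟩ := ihf
    obtain ⟨H, hH, hHm, hHh⟩ := ihh
    refine ⟨fun τ n => (F τ n).bind fun x => (H τ n).map fun y => Nat.pair x y, ?_, ?_, ?_⟩
    · exact Primrec.option_bind hF (Primrec.option_map (hH.comp (Primrec.fst.comp Primrec.fst)
        (Primrec.snd.comp Primrec.fst)) (Primrec₂.natPair.comp (Primrec.snd.comp Primrec.fst)
        Primrec.snd))
    · intro k l n y hkl h
      simp only [Option.bind_eq_some_iff, Option.map_eq_some_iff] at h ⊢
      obtain ⟨x, hx, z, hz, rfl⟩ := h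
      exact ⟨x, hFm _ _ _ _ hkl hx, z, hHm _ _ _ _ hkl hz, rfl⟩
    · intro n y
      simp only [Option.bind_eq_some_iff, Option.map_eq_some_iff, Seq.seq, Part.map_eq_map,
        Part.mem_bind_iff, Part.mem_map_iff, hFf, hHh]
      constructor
      · rintro ⟨_, ⟨x, ⟨k, hk⟩, rfl⟩, z, ⟨l, hl⟩, rfl⟩
        exact ⟨max k l, x, hFm _ _ _ _ (le_max_left _ _) hk, z,
          hHm _ _ _ _ (le_max_right _ _) hl, rfl⟩
      · rintro ⟨k, x, hx, z, hz, rfl⟩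
        exact ⟨_, ⟨x, ⟨k, hx⟩, rfl⟩, z, ⟨k, hz⟩, rfl⟩
  | @comp f h _ _ ihf ihh =>
    obtain ⟨F, hF, hFm, hFf⟩ := ihf
    obtain ⟨H, hH, hHm, hHh⟩ := ihh
    refine ⟨fun τ n => (H τ n).bind fun x => F τ x, ?_, ?_, ?_⟩
    · exact Primrec.option_bind hH (hF.comp (Primrec.fst.comp Primrec.fst) Primrec.snd)
    · intro k l n y hkl h
      simp only [Option.bind_eq_some_iff] at h ⊢
      obtain ⟨x, hx, hy⟩ := h
      exact ⟨x, hHm _ _ _ _ hkl hx, hFm _ _ _ _ hkl hy⟩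
    · intro n y
      refine Part.mem_bind_iff.trans ?_
      simp only [Option.bind_eq_some_iff, hFf, hHh]
      constructor
      · rintro ⟨x, ⟨k, hk⟩, l, hl⟩
        exact ⟨max k l, x, hHm _ _ _ _ (le_max_left _ _) hk, hFm _ _ _ _ (le_max_right _ _) hl⟩
      · rintro ⟨k, x, hx, hy⟩
        exact ⟨x, ⟨k, hx⟩, k, hy⟩
  | @prec f h _ _ ihf ihh =>
    obtain ⟨F, hF, hFm, hFf⟩ := ihf
    obtain ⟨H, hH, hHm, hHh⟩ := ihh
    let G : List (Fin 2) → ℕ → ℕ → Option ℕ := fun τ a m =>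
      Nat.rec (F τ a) (fun y IH => IH.bind fun i => H τ (Nat.pair a (Nat.pair y i))) m
    have hGm : ∀ k l a m y, k ≤ l → G (digitPrefix b k) a m = some y →
        G (digitPrefix b l) a m = some y := by
      intro k l a m y hkl
      induction m generalizing y with
      | zero => exact hFm _ _ _ _ hkl
      | succ m ih =>
        intro h
        change Option.bind (G _ a m) _ = _ at h
        change Option.bind (G _ a m) _ = _
        simp only [Option.bind_eq_some_iff] at h ⊢
        obtain ⟨x, hx, hy⟩ := h
        exact ⟨x, ih _ hx, hHm _ _ _ _ hkl hy⟩
    refine ⟨fun τ n => G τ n.unpair.1 n.unpair.2, ?_, fun k l n y hkl => hGm k l _ _ y hkl, ?_⟩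
    · refine Primrec.nat_rec' (f := fun q : List (Fin 2) × ℕ => q.2.unpair.2)
        (g := fun q : List (Fin 2) × ℕ => F q.1 q.2.unpair.1)
        (h := fun (q : List (Fin 2) × ℕ) (w : ℕ × Option ℕ) =>
          w.2.bind fun i => H q.1 (Nat.pair q.2.unpair.1 (Nat.pair w.1 i))) ?_ ?_ ?_
      · exact Primrec.snd.comp (Primrec.unpair.comp Primrec.snd)
      · exact hF.comp Primrec.fst (Primrec.fst.comp (Primrec.unpair.comp Primrec.snd))
      · refine Primrec.option_bind (Primrec.snd.comp Primrec.snd) ?_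
        refine hH.comp (Primrec.fst.comp (Primrec.fst.comp Primrec.fst)) ?_
        refine Primrec₂.natPair.comp (Primrec.fst.comp (Primrec.unpair.comp
          (Primrec.snd.comp (Primrec.fst.comp Primrec.fst)))) ?_
        exact Primrec₂.natPair.comp (Primrec.fst.comp (Primrec.snd.comp Primrec.fst)) Primrec.snd
    · intro n y
      dsimp only
      generalize n.unpair.1 = a
      generalize n.unpair.2 = m
      induction m generalizing y with
      | zero => exact hFf a y
      | succ m ih =>
        change y ∈ Part.bind _ _ ↔ ∃ k, Option.bind (G _ a m) _ = some y
        simp only [Option.bind_eq_some_iff, Part.mem_bind_iff, hHh]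
        constructor
        · rintro ⟨x, hx, l, hl⟩
          obtain ⟨k, hk⟩ := (ih x).1 hx
          exact ⟨max k l, x, hGm _ _ _ _ _ (le_max_left _ _) hk,
            hHm _ _ _ _ (le_max_right _ _) hl⟩
        · rintro ⟨k, x, hx, hy⟩
          exact ⟨x, (ih x).2 ⟨k, hx⟩, k, hy⟩
  | @rfind f _ ihf =>
    obtain ⟨F, hF, hFm, hFf⟩ := ihf
    -- Undefined values default to `0`, so the search stops at the first value that is zero or not
    -- yet known. The outcome counts only if it is a genuine `some 0`. If nothing is found,
    -- `findIdx` returns the length of the list, whence `m ≤ k` in `key`.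
    let c : List (Fin 2) → ℕ → ℕ → Bool := fun τ n m =>
      decide ((F τ (Nat.pair n m)).getD 0 = 0)
    let M : List (Fin 2) → ℕ → ℕ := fun τ n => (List.range τ.length).findIdx (c τ n)
    have key : ∀ k n m, (if F (digitPrefix b k) (Nat.pair n (M (digitPrefix b k) n)) = some 0
          then some (M (digitPrefix b k) n) else none) = some m ↔
        m ≤ k ∧ F (digitPrefix b k) (Nat.pair n m) = some 0 ∧
          ∀ i < m, ∃ y, F (digitPrefix b k) (Nat.pair n i) = some (y + 1) := by
      intro k n m
      have hc : ∀ i, c (digitPrefix b k) n i = false ↔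
          ∃ y, F (digitPrefix b k) (Nat.pair n i) = some (y + 1) := by
        intro i
        simp only [c, decide_eq_false_iff_not]
        rcases F (digitPrefix b k) (Nat.pair n i) with _ | _ | y <;> simp
      constructor
      · intro h
        split_ifs at h with h0
        obtain rfl : M (digitPrefix b k) n = m := by simpa using h
        have hle : M (digitPrefix b k) n ≤ k := by
          simpa [M, length_digitPrefix] using
            List.findIdx_le_length (xs := List.range k) (p := c (digitPrefix b k) n)
        refine ⟨hle, h0, fun i hi => (hc i).1 ?_⟩
        have := List.not_of_lt_findIdx hi
        simpa using this
      · rintro ⟨hle, h0, hi⟩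
        have hM : M (digitPrefix b k) n = m := by
          apply le_antisymm
          · by_contra! hlt
            have := List.not_of_lt_findIdx hlt
            simp [c, h0] at this
          · by_contra! hlt
            have hlt' : M (digitPrefix b k) n < (List.range (digitPrefix b k).length).length := by
              simp [length_digitPrefix]; omega
            have := List.findIdx_getElem (w := hlt')
            have h2 := (hc _).2 (hi _ hlt)
            simp [M] at this h2
            rw [this] at h2
            exact absurd h2 (by simp)
        rw [hM, if_pos h0]
    refine ⟨fun τ n => if F τ (Nat.pair n (M τ n)) = some 0 then some (M τ n) else none,
      ?_, ?_, ?_⟩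
    · have hM : Primrec₂ M := by
        refine Primrec.list_findIdx (Primrec.list_range.comp
          (Primrec.list_length.comp Primrec.fst)) ?_
        refine PrimrecRel.decide (R := fun (q : List (Fin 2) × ℕ) m =>
          (F q.1 (Nat.pair q.2 m)).getD 0 = 0) ?_
        refine Primrec.eq.comp (Primrec.option_getD.comp (hF.comp (Primrec.fst.comp Primrec.fst)
          (Primrec₂.natPair.comp (Primrec.snd.comp Primrec.fst) Primrec.snd))
          (Primrec.const 0)) (Primrec.const 0)
      exact Primrec.ite (Primrec.eq.comp (hF.comp Primrec.fst
        (Primrec₂.natPair.comp Primrec.snd hM)) (Primrec.const (some 0)))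
        (Primrec.option_some.comp hM) (Primrec.const none)
    · intro k l n m hkl h
      rw [key] at h ⊢
      exact ⟨h.1.trans hkl, hFm _ _ _ _ hkl h.2.1, fun i hi =>
        (h.2.2 i hi).imp fun y hy => hFm _ _ _ _ hkl hy⟩
    · intro n m
      refine Nat.mem_rfind.trans ?_
      simp only [key, Part.map_eq_map, Part.mem_map_iff, hFf]
      constructor
      · rintro ⟨⟨x, ⟨k, hk⟩, hx⟩, hi⟩
        have hi' : ∀ i < m, ∃ k y, F (digitPrefix b k) (Nat.pair n i) = some (y + 1) := by
          intro i him
          obtain ⟨x, ⟨k, hk⟩, hx⟩ := hi him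
          obtain ⟨y, rfl⟩ := Nat.exists_eq_succ_of_ne_zero (by simpa using hx)
          exact ⟨k, y, hk⟩
        choose! g hg using hi'
        obtain rfl : x = 0 := by simpa using hx
        refine ⟨max (max k m) ((Finset.range m).sup g), by simp,
          hFm _ _ _ _ (by simp) hk, fun i him => ?_⟩
        obtain ⟨y, hy⟩ := hg i him
        exact ⟨y, hFm _ _ _ _ (le_max_of_le_right
          (Finset.le_sup (f := g) (Finset.mem_range.2 him))) hy⟩
      · rintro ⟨k, -, h0, hi⟩
        refine ⟨⟨0, ⟨k, h0⟩, by simp⟩, fun him => ?_⟩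
        obtain ⟨y, hy⟩ := hi _ him
        exact ⟨y + 1, ⟨k, hy⟩, by simp⟩

/-- Together with its converse `REPred.exists_digitPrefix`, this normal form reduces enumerability
with an oracle to plain enumerability with the prefix as an extra argument. -/
theorem REPredIn.exists_initialSegment {b : ℕ → Fin 2} {P : α → Prop}
    (hP : REPredIn (digitOracle b) P) :
    ∃ V : List (Fin 2) × α → Prop, REPred V ∧ ∀ a, P a ↔ ∃ k, V (digitPrefix b k, a) := by
  obtain ⟨F, hF, -, hFP⟩ := exists_primrec_approx hP
  refine ⟨fun q => (F q.1 (encode q.2)).isSome = true, ?_, fun a => ?_⟩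
  · exact PrimrecPred.rePred (Primrec.eq.comp (Primrec.option_isSome.comp (hF.comp Primrec.fst
      (Primrec.encode.comp Primrec.snd))) (Primrec.const true))
  · have h := hFP (encode a)
    simp only [encodek, Part.coe_some, Part.bind_some] at h
    constructor
    · intro ha
      obtain ⟨k, hk⟩ := (h 0).1 (by simp [Part.assert_pos ha])
      exact ⟨k, by simp [hk]⟩
    · rintro ⟨k, hk⟩
      obtain ⟨y, hy⟩ := Option.isSome_iff_exists.1 hk
      obtain ⟨u, hu, -⟩ := (Part.mem_map_iff _).1 ((h y).2 ⟨k, hy⟩)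
      exact (Part.mem_assert_iff.1 hu).1

theorem recursiveIn_digitPrefix (b : ℕ → Fin 2) :
    Nat.RecursiveIn (digitOracle b) fun k => Part.some (encode (digitPrefix b k)) := by
  have happ : Nat.Primrec fun n : ℕ => encode (((decode (α := List (Fin 2)) n.unpair.1).getD []) ++
      [Fin.ofNat 2 n.unpair.2]) := by
    refine Primrec.nat_iff.1 (Primrec.encode.comp (Primrec.list_concat.comp ?_ ?_))
    · exact Primrec.option_getD.comp (Primrec.decode.comp (Primrec.fst.comp Primrec.unpair))
        (Primrec.const [])
    · refine Primrec.fin_val_iff.1 ?_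
      exact Primrec.nat_mod.comp (Primrec.snd.comp Primrec.unpair) (Primrec.const 2)
  have hr : Nat.RecursiveIn (digitOracle b) fun n => Part.some n.unpair.2 := .right
  have hl : Nat.RecursiveIn (digitOracle b) fun n => Part.some n.unpair.1 := .left
  have ho : Nat.RecursiveIn (digitOracle b) fun n => Part.some ((b n : Fin 2) : ℕ) :=
    .oracle _ rfl
  have hstep : Nat.RecursiveIn (digitOracle b) fun n => Part.some (encode
      (((decode (α := List (Fin 2)) n.unpair.2.unpair.2).getD []) ++ [b n.unpair.2.unpair.1])) := by
    refine ((happ.recursiveIn (O := digitOracle b)).comp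
      (.pair (hr.comp hr) (ho.comp (hl.comp hr)))).of_eq fun n => ?_
    simp [Seq.seq]
  have hz : Nat.RecursiveIn (digitOracle b) fun _ => Part.some (encode ([] : List (Fin 2))) := by
    exact (Nat.Primrec.const _).recursiveIn
  refine ((Nat.RecursiveIn.prec hz hstep).comp (.pair .zero
    ((Nat.Primrec.id).recursiveIn))).of_eq fun k => ?_
  have : (Seq.seq (Nat.pair <$> (0 : Part ℕ)) fun _ => ((id k : ℕ) : Part ℕ)) =
      Part.some (Nat.pair 0 k) := by
    change Part.bind (Part.map _ (Part.some 0)) _ = _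
    simp
  rw [this]
  simp only [Part.bind_eq_bind, Part.bind_some, Nat.unpair_pair]
  induction k with
  | zero => rfl
  | succ k ih =>
    simp only []
    rw [ih]
    · simp [digitPrefix_succ]
    · change Part.bind (Part.map _ (Part.some 0)) _ = _
      simp

theorem REPred.exists_digitPrefix {b : ℕ → Fin 2} {V : List (Fin 2) × α → Prop} (hV : REPred V) :
    REPredIn (digitOracle b) fun a => ∃ k, V (digitPrefix b k, a) := by
  classical
  obtain ⟨D, hD, -, hVD⟩ := hV.exists_primrec
  -- The prefix enters `H` only through its code, so `H` needs no oracle. The value `0` signals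
  -- success, as `rfind` looks for a zero.
  let H : ℕ → ℕ := fun w =>
    if ∃ a ∈ (decode (α := α) w.unpair.2.unpair.1).toList,
      D ((decode (α := List (Fin 2)) w.unpair.1).getD [], a) w.unpair.2.unpair.2.unpair.2
    then 0 else 1
  have hu1 : Primrec fun w : ℕ => w.unpair.1 := Primrec.fst.comp Primrec.unpair
  have hu2 : Primrec fun w : ℕ => w.unpair.2 := Primrec.snd.comp Primrec.unpair
  have hH : Nat.Primrec H := by
    refine Primrec.nat_iff.1 (Primrec.ite ?_ (Primrec.const 0) (Primrec.const 1))
    have h1 : PrimrecRel fun (a : α) (w : ℕ) =>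
        D ((decode (α := List (Fin 2)) w.unpair.1).getD [], a) w.unpair.2.unpair.2.unpair.2 :=
      hD.comp (Primrec.pair (Primrec.option_getD.comp (Primrec.decode.comp
        (hu1.comp Primrec.snd)) (Primrec.const [])) Primrec.fst)
        (hu2.comp (hu2.comp (hu2.comp Primrec.snd)))
    exact h1.exists_mem_list.comp (Primrec.optionToList.comp (Primrec.decode.comp
      (hu1.comp hu2))) Primrec.id
  have hg : Nat.RecursiveIn (digitOracle b) fun w => Part.some (H (Nat.pair
      (encode (digitPrefix b w.unpair.2.unpair.1)) w)) := by
    refine ((hH.recursiveIn (O := digitOracle b)).comp (.pair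
      ((recursiveIn_digitPrefix b).comp
        (Primrec.nat_iff.1 (hu1.comp hu2)).recursiveIn)
      (Nat.Primrec.id.recursiveIn))).of_eq fun n => ?_
    simp [Seq.seq]
  -- The search runs over pairs of a prefix length and a time bound. Only its termination matters;
  -- the number found is replaced by `0`, the code of `()`.
  refine ((Nat.RecursiveIn.zero).comp (Nat.RecursiveIn.rfind hg)).of_eq fun n => ?_
  refine Part.ext fun y => ?_
  change y ∈ Part.bind _ (fun _ => Part.some 0) ↔ _
  simp only [Part.mem_bind_iff, Part.mem_some_iff, exists_and_right]
  rw [← Part.dom_iff_mem]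
  refine (and_congr_left' Nat.rfind_dom').trans ?_
  have hdom : ∀ m, (∃ a ∈ (decode (α := α) n).toList, D (digitPrefix b m.unpair.1, a) m.unpair.2) ↔
      true ∈ ((fun m => decide (m = 0)) <$> Part.some (H (Nat.pair (encode (digitPrefix b
        (Nat.pair n m).unpair.2.unpair.1)) (Nat.pair n m)))) := by
    intro m
    simp [H]
  simp only [← hdom]
  have hP : ∀ a, (∃ k, V (digitPrefix b k, a)) ↔
      ∃ m : ℕ, D (digitPrefix b m.unpair.1, a) m.unpair.2 := by
    intro a
    simp only [hVD]
    constructor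
    · rintro ⟨k, s, h⟩; exact ⟨Nat.pair k s, by simpa using h⟩
    · rintro ⟨m, h⟩; exact ⟨_, _, h⟩
  rcases hdec : decode (α := α) n with _ | a
  · simp
  · simp only [Option.toList_some, List.mem_singleton, exists_eq_left, Part.coe_some,
      Part.mem_map_iff, Part.mem_assert_iff, hP]
    simp [eq_comm]
    exact fun _ _ => ⟨fun h => ⟨(), h⟩, fun ⟨_, h⟩ => h⟩

end BernoulliTests

/-! ### Cylinders and Bernoulli measures of words -/

namespace BernoulliTests

theorem digitPrefix_eq_ofFn {β : Type} (b : ℕ → β) (k : ℕ) :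
    digitPrefix b k = List.ofFn fun i : Fin k => b i := by
  apply List.ext_getElem <;> simp [digitPrefix]

theorem mem_wordCylinder_iff {ω : Omega} {x : List Bool} :
    ω ∈ wordCylinder x ↔ digitPrefix ω x.length = x := by
  rw [digitPrefix_eq_ofFn]
  constructor
  · intro h
    apply List.ext_getElem
    · simp
    · intro i h1 h2
      simpa using h ⟨i, h2⟩
  · intro h i
    have := congrArg (fun l : List Bool => l[(i : ℕ)]?) h
    simpa using this

theorem digitPrefix_take {β : Type} (b : ℕ → β) {k l : ℕ} (h : k ≤ l) :
    (digitPrefix b l).take k = digitPrefix b k := by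
  simp [digitPrefix, ← List.map_take, List.take_range, h]

theorem prefix_digitPrefix_iff {ω : Omega} {x : List Bool} {s : ℕ} :
    x <+: digitPrefix ω s ↔ x.length ≤ s ∧ ω ∈ wordCylinder x := by
  rw [mem_wordCylinder_iff]
  constructor
  · intro h
    have hl : x.length ≤ s := by simpa [length_digitPrefix] using h.length_le
    refine ⟨hl, ?_⟩
    rw [List.prefix_iff_eq_take, digitPrefix_take _ hl] at h
    exact h.symm
  · rintro ⟨hl, h⟩
    rw [List.prefix_iff_eq_take, digitPrefix_take _ hl, h]

theorem mem_wordCylinder_of_isPrefix {ω : Omega} {x y : List Bool} (h : x <+: y)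
    (hy : ω ∈ wordCylinder y) : ω ∈ wordCylinder x := by
  rw [mem_wordCylinder_iff] at hy
  exact (prefix_digitPrefix_iff (s := y.length).1 (by rwa [hy])).2

theorem mem_wordCylinder_digitPrefix (ω : Omega) (s : ℕ) :
    ω ∈ wordCylinder (digitPrefix ω s) := by
  rw [mem_wordCylinder_iff, length_digitPrefix]

theorem measurableSet_wordCylinder (x : List Bool) : MeasurableSet (wordCylinder x) := by
  have : wordCylinder x = ⋂ i : Fin x.length, (fun ω : Omega => ω i) ⁻¹' {x.get i} := by
    ext ω; simp [wordCylinder]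
  rw [this]
  exact MeasurableSet.iInter fun i => measurable_pi_apply _ (MeasurableSet.singleton _)

/-- The probability of the digit `d` when `1` has probability `p`. -/
noncomputable def digitProb (p : I) (d : Bool) : ℝ := if d then p else 1 - p

theorem digitProb_nonneg (p : I) (d : Bool) : 0 ≤ digitProb p d := by
  unfold digitProb; split_ifs
  · exact p.2.1
  · linarith [p.2.2]

theorem bernoulliMeasure_singleton (p : I) (d : Bool) :
    bernoulliMeasure true false p {d} = ENNReal.ofReal (digitProb p d) := by
  classical
  rw [bernoulliMeasure_apply p (MeasurableSet.singleton d)]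
  cases d
  · simp [digitProb, ENNReal.ofReal, unitInterval.toNNReal, Real.toNNReal,
      max_eq_left (show (0 : ℝ) ≤ 1 - p by linarith [p.2.2])]
    rfl
  · simp [digitProb, ENNReal.ofReal, unitInterval.toNNReal, Real.toNNReal,
      max_eq_left p.2.1]
    rfl

/-- The probability `B_p(xΩ)`. -/
noncomputable def wordProb (p : I) (x : List Bool) : ℝ≥0∞ :=
  (x.map fun d => ENNReal.ofReal (digitProb p d)).prod

theorem bernoulliProd_wordCylinder (p : I) (x : List Bool) :
    bernoulliProd p (wordCylinder x) = wordProb p x := by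
  have h : wordCylinder x = Set.pi (Finset.range x.length) fun i => {x.getD i false} := by
    ext ω
    simp only [wordCylinder, Set.mem_ofPred_eq, Set.mem_pi, Finset.coe_range, Set.mem_Iio,
      Set.mem_singleton_iff]
    constructor
    · intro h i hi
      simpa [hi] using h ⟨i, hi⟩
    · intro h i
      simpa using h i i.2
  rw [h, bernoulliProd, Measure.infinitePi_pi _ (fun i _ => MeasurableSet.singleton _)]
  simp only [bernoulliMeasure_singleton]
  rw [Finset.prod_range, wordProb, ← Fin.prod_univ_fun_getElem]
  simp

instance (p : I) : IsProbabilityMeasure (bernoulliProd p) := by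
  unfold bernoulliProd; infer_instance

/-- The list of all binary words of length `s`. -/
def words : ℕ → List (List Bool)
  | 0 => [[]]
  | s + 1 => (words s).flatMap fun w => [true :: w, false :: w]

theorem length_of_mem_words {s : ℕ} {y : List Bool} (h : y ∈ words s) : y.length = s := by
  induction s generalizing y with
  | zero => simpa [words] using h
  | succ s ih =>
    simp only [words, List.mem_flatMap, List.mem_cons, List.not_mem_nil, or_false] at h
    obtain ⟨w, hw, rfl | rfl⟩ := h <;> simp [ih hw]

/-- Each word occurs exactly once among the words of its length. Hence a function of the first `s`
digits is a sum of indicators of cylinders, and its integral is a finite sum. -/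
theorem sum_words_ite (G : List Bool → ℝ≥0∞) (z : List Bool) :
    ((words z.length).map fun y => if z = y then G y else 0).sum = G z := by
  induction z generalizing G with
  | nil => simp [words]
  | cons d z ih =>
    simp only [List.length_cons, words]
    have : ∀ l : List (List Bool), ((l.flatMap fun w => [true :: w, false :: w]).map
        fun y => if d :: z = y then G y else 0).sum =
        (l.map fun y => if z = y then G (d :: y) else 0).sum := by
      intro l
      induction l with
      | nil => simp
      | cons w l ihl =>
        rw [List.flatMap_cons, List.map_append, List.sum_append, ihl]
        cases d <;> simp
    rw [this]
    exact ih fun y => G (d :: y)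

theorem lintegral_list_sum {X Y : Type} [MeasurableSpace X] (μ : Measure X) (l : List Y)
    (f : Y → X → ℝ≥0∞) (hf : ∀ y, Measurable (f y)) :
    ∫⁻ x, (l.map fun y => f y x).sum ∂μ = (l.map fun y => ∫⁻ x, f y x ∂μ).sum := by
  induction l with
  | nil => simp
  | cons y l ih => simp only [List.map_cons, List.sum_cons]; rw [lintegral_add_left (hf y), ih]

theorem digitPrefix_comp_eq_sum (φ : List Bool → ℝ≥0∞) (s : ℕ) (ω : Omega) :
    φ (digitPrefix ω s) =
      ((words s).map fun y => (wordCylinder y).indicator (fun _ => φ y) ω).sum := by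
  conv_lhs => rw [← sum_words_ite φ (digitPrefix ω s), length_digitPrefix]
  congr 1
  refine List.map_congr_left fun y hy => ?_
  simp only [Set.indicator, mem_wordCylinder_iff, length_of_mem_words hy]

theorem measurable_digitPrefix_comp (φ : List Bool → ℝ≥0∞) (s : ℕ) :
    Measurable fun ω : Omega => φ (digitPrefix ω s) := by
  simp only [digitPrefix_comp_eq_sum φ s]
  induction words s with
  | nil => simp
  | cons y l ih =>
    simp only [List.map_cons, List.sum_cons]
    exact (measurable_const.indicator (measurableSet_wordCylinder y)).add ih

theorem lintegral_digitPrefix_comp (p : I) (φ : List Bool → ℝ≥0∞) (s : ℕ) :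
    ∫⁻ ω, φ (digitPrefix ω s) ∂(bernoulliProd p) =
      ((words s).map fun y => φ y * wordProb p y).sum := by
  simp only [digitPrefix_comp_eq_sum φ s]
  rw [lintegral_list_sum _ _ _ fun y =>
    measurable_const.indicator (measurableSet_wordCylinder y)]
  congr 1
  refine List.map_congr_left fun y _ => ?_
  rw [lintegral_indicator_const (measurableSet_wordCylinder y), bernoulliProd_wordCylinder]

/-! ### Pieces and a decidable bound on their integrals -/

/-- A piece `(r, x, n, k)` stands for the function equal to `r` on `xΩ × J`, where `J` is the
interval with center `k / 2 ^ n` and radius `1 / 2 ^ n`. -/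
abbrev Piece : Type := ℕ × List Bool × ℕ × ℕ

/-- The open interval with center `k / 2 ^ n` and radius `1 / 2 ^ n`. -/
def dyadicOpen (n k : ℕ) : Set ℝ := {p | (k : ℝ) < p * 2 ^ n + 1 ∧ p * 2 ^ n < k + 1}

/-- The closed interval with center `k / 2 ^ n` and radius `1 / 2 ^ n`. -/
def dyadicClosed (n k : ℕ) : Set ℝ := {p | (k : ℝ) ≤ p * 2 ^ n + 1 ∧ p * 2 ^ n ≤ k + 1}

theorem dyadicOpen_subset_dyadicClosed (n k : ℕ) : dyadicOpen n k ⊆ dyadicClosed n k :=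
  fun _ h => ⟨h.1.le, h.2.le⟩

/-- The closed interval of the piece `e` meets the closed interval with center `j / 2 ^ m` and
radius `1 / 2 ^ m`. -/
def Meets (m j : ℕ) (e : Piece) : Prop :=
  e.2.2.2 * 2 ^ m ≤ (j + 1) * 2 ^ e.2.2.1 + 2 ^ m ∧
    j * 2 ^ e.2.2.1 ≤ (e.2.2.2 + 1) * 2 ^ m + 2 ^ e.2.2.1

instance (m j : ℕ) : DecidablePred (Meets m j) := fun _ => inferInstanceAs (Decidable (_ ∧ _))

theorem meets_of_mem {m j : ℕ} {e : Piece} {p : ℝ} (hp : p ∈ dyadicOpen m j)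
    (he : p ∈ dyadicClosed e.2.2.1 e.2.2.2) : Meets m j e := by
  obtain ⟨r, x, n, k⟩ := e
  obtain ⟨h1, h2⟩ := hp
  obtain ⟨h3, h4⟩ := he
  have hm : (0 : ℝ) < 2 ^ m := by positivity
  have hn : (0 : ℝ) < 2 ^ n := by positivity
  constructor
  · have : (k : ℝ) * 2 ^ m ≤ (j + 1) * 2 ^ n + 2 ^ m := by
      dsimp only at h3
      nlinarith
    exact_mod_cast this
  · have : (j : ℝ) * 2 ^ n ≤ (k + 1) * 2 ^ m + 2 ^ n := by
      dsimp only at h4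
      nlinarith
    exact_mod_cast this

/-- The largest value on `yΩ` of the pieces from `L` that satisfy `q`. -/
def maxValue (q : Piece → Prop) [DecidablePred q] (L : List Piece) (y : List Bool) : ℕ :=
  L.foldr (fun e v => max (if q e ∧ y.take e.2.1.length = e.2.1 then e.1 else 0) v) 0

theorem maxValue_le_iff {q : Piece → Prop} [DecidablePred q] {L : List Piece} {y : List Bool}
    {v : ℕ} : maxValue q L y ≤ v ↔ ∀ e ∈ L, q e → e.2.1 <+: y → e.1 ≤ v := by
  unfold maxValue
  induction L with
  | nil => simp
  | cons e L ih =>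
    simp only [List.foldr_cons, max_le_iff, ih, List.mem_cons, forall_eq_or_imp]
    refine and_congr_left fun _ => ?_
    rw [List.prefix_iff_eq_take, eq_comm (a := e.2.1)]
    split_ifs with h <;> grind

theorem le_maxValue {q : Piece → Prop} [DecidablePred q] {L : List Piece} {y : List Bool}
    {e : Piece} (he : e ∈ L) (hq : q e) (hy : e.2.1 <+: y) : e.1 ≤ maxValue q L y :=
  maxValue_le_iff.1 le_rfl e he hq hy

theorem maxValue_mono {q q' : Piece → Prop} [DecidablePred q] [DecidablePred q'] {L : List Piece}
    {y : List Bool} (h : ∀ e ∈ L, q e → q' e) : maxValue q L y ≤ maxValue q' L y :=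
  maxValue_le_iff.2 fun e he hq hy => le_maxValue he (h e he hq) hy

/-- An upper bound for `2 ^ (m * |y|) * B_p(yΩ)` when `p` is in `dyadicOpen m j`. -/
def wordWeight (m j : ℕ) (y : List Bool) : ℕ :=
  y.foldr (fun d v => (if d then j + 1 else 2 ^ m + 1 - j) * v) 1

/-- A decidable condition that bounds by `2` the `B_p`-integral of the maximum of the pieces in
`L`, for all `p` in `dyadicOpen m j`. -/
def Bounded (L : List Piece) (s m j : ℕ) : Prop :=
  (words s).foldr (fun y v => wordWeight m j y * maxValue (Meets m j) L y + v) 0 ≤ 2 * 2 ^ (m * s)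

theorem foldr_add_eq_sum {Y : Type} (l : List Y) (f : Y → ℕ) :
    l.foldr (fun y v => f y + v) 0 = (l.map f).sum := by
  induction l with
  | nil => rfl
  | cons y l ih => simp [ih]

theorem digit_bound_le {m j : ℕ} {p : I} (hp : (p : ℝ) ∈ dyadicOpen m j) (d : Bool) :
    2 ^ m * digitProb p d ≤ ((if d then j + 1 else 2 ^ m + 1 - j : ℕ) : ℝ) := by
  obtain ⟨h1, h2⟩ := hp
  have hm : (0 : ℝ) < 2 ^ m := by positivity
  cases d
  · simp only [digitProb, Bool.false_eq_true, if_false]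
    -- Needed so that the natural subtraction `2 ^ m + 1 - j` is not truncated.
    have hj : j ≤ 2 ^ m + 1 := by
      have : (j : ℝ) ≤ 2 ^ m + 1 := by nlinarith [p.2.2]
      exact_mod_cast this
    push_cast [Nat.cast_sub hj]
    nlinarith
  · simp only [digitProb, if_true]
    push_cast
    nlinarith

/-- The interval has length `2 * (2 ^ m)⁻¹`, so its extreme digit probability exceeds the one at `p`
by at most that much. The error vanishes as `m` grows. -/
theorem le_digit_bound {m j : ℕ} {p : I} (hp : (p : ℝ) ∈ dyadicOpen m j) (d : Bool) :
    ((if d then j + 1 else 2 ^ m + 1 - j : ℕ) : ℝ) ≤ 2 ^ m * (digitProb p d + 2 * (2 ^ m)⁻¹) := by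
  obtain ⟨h1, h2⟩ := hp
  have hm : (0 : ℝ) < 2 ^ m := by positivity
  have hm' : (2 : ℝ) ^ m * (2 * (2 ^ m)⁻¹) = 2 := by field_simp
  rw [mul_add, hm']
  cases d
  · simp only [digitProb, Bool.false_eq_true, if_false]
    have hj : j ≤ 2 ^ m + 1 := by
      have : (j : ℝ) ≤ 2 ^ m + 1 := by nlinarith [p.2.2]
      exact_mod_cast this
    push_cast [Nat.cast_sub hj]
    nlinarith
  · simp only [digitProb, if_true]
    push_cast
    nlinarith

theorem wordProb_le_wordWeight {m j : ℕ} {p : I} (hp : (p : ℝ) ∈ dyadicOpen m j) (y : List Bool) :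
    2 ^ (m * y.length) * wordProb p y ≤ (wordWeight m j y : ℝ≥0∞) := by
  induction y with
  | nil => simp [wordProb, wordWeight]
  | cons d y ih =>
    have hd : (2 : ℝ≥0∞) ^ m * ENNReal.ofReal (digitProb p d) ≤
        ((if d then j + 1 else 2 ^ m + 1 - j : ℕ) : ℝ≥0∞) := by
      rw [← ENNReal.ofReal_natCast, ← ENNReal.ofReal_ofNat, ← ENNReal.ofReal_pow (by norm_num),
        ← ENNReal.ofReal_mul (by positivity)]
      exact ENNReal.ofReal_le_ofReal (digit_bound_le hp d)
    calc (2 : ℝ≥0∞) ^ (m * (d :: y).length) * wordProb p (d :: y)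
        = (2 ^ m * ENNReal.ofReal (digitProb p d)) * (2 ^ (m * y.length) * wordProb p y) := by
          simp only [wordProb, List.length_cons, List.map_cons, List.prod_cons, mul_add, mul_one,
            pow_add]
          ring
      _ ≤ _ := mul_le_mul' hd ih
      _ = (wordWeight m j (d :: y) : ℝ≥0∞) := by
          simp only [wordWeight, List.foldr_cons, Nat.cast_mul]

theorem wordWeight_le {m j : ℕ} {p : I} (hp : (p : ℝ) ∈ dyadicOpen m j) (y : List Bool) :
    (wordWeight m j y : ℝ) ≤
      2 ^ (m * y.length) * (y.map fun d => digitProb p d + 2 * (2 ^ m)⁻¹).prod := by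
  induction y with
  | nil => simp [wordWeight]
  | cons d y ih =>
    have h0 := digitProb_nonneg p d
    calc (wordWeight m j (d :: y) : ℝ)
        = ((if d then j + 1 else 2 ^ m + 1 - j : ℕ) : ℝ) * wordWeight m j y := by
          simp only [wordWeight, List.foldr_cons, Nat.cast_mul]
      _ ≤ _ := mul_le_mul (le_digit_bound hp d) ih (by positivity) (by positivity)
      _ = _ := by
          simp only [List.length_cons, List.map_cons, List.prod_cons, mul_add, mul_one, pow_add]
          ring

open Classical in
-- Soundness of the check: over the interval, each word weight is an upper bound for the scaled word
-- probability, and every piece active at `p` is counted because its interval meets `dyadicOpen m j`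
-- at `p`.
theorem Bounded.lintegral_le {L : List Piece} {s m j : ℕ} (h : Bounded L s m j) {p : I}
    (hp : (p : ℝ) ∈ dyadicOpen m j) :
    ∫⁻ ω, (maxValue (fun e => (p : ℝ) ∈ dyadicClosed e.2.2.1 e.2.2.2) L (digitPrefix ω s) : ℝ≥0∞)
      ∂(bernoulliProd p) ≤ 2 := by
  rw [lintegral_digitPrefix_comp p (fun y =>
    (maxValue (fun e => (p : ℝ) ∈ dyadicClosed e.2.2.1 e.2.2.2) L y : ℝ≥0∞)) s]
  have hpow0 : (2 : ℝ≥0∞) ^ (m * s) ≠ 0 := by simp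
  have hpowt : (2 : ℝ≥0∞) ^ (m * s) ≠ ∞ := by simp
  refine (ENNReal.mul_le_mul_iff_right hpow0 hpowt).1 ?_
  rw [Bounded, foldr_add_eq_sum] at h
  have h' : (((words s).map fun y => wordWeight m j y * maxValue (Meets m j) L y).sum : ℝ≥0∞) ≤
      2 ^ (m * s) * 2 := by
    rw [mul_comm]; exact_mod_cast h
  refine le_trans ?_ h'
  rw [← List.sum_map_mul_left, Nat.cast_list_sum, List.map_map]
  refine List.sum_le_sum fun y hy => ?_
  have hw := wordProb_le_wordWeight hp y
  rw [length_of_mem_words hy] at hw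
  simp only [Function.comp_apply, Nat.cast_mul]
  rw [mul_left_comm, mul_comm]
  refine mul_le_mul' hw ?_
  exact_mod_cast maxValue_mono fun e _ he => meets_of_mem hp he

open Classical Filter in
-- Completeness of the check: for small intervals around `p` the word weights tend to the true
-- probabilities and no piece inactive at `p` is counted, so the sum drops below `2`.
theorem eventually_bounded {L : List Piece} {s : ℕ} {p : I}
    (h : ∫⁻ ω, (maxValue (fun e => (p : ℝ) ∈ dyadicClosed e.2.2.1 e.2.2.2) L (digitPrefix ω s) :
      ℝ≥0∞) ∂(bernoulliProd p) ≤ 1) :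
    ∀ᶠ m in atTop, ∀ j, (p : ℝ) ∈ dyadicOpen m j → Bounded L s m j := by
  set q : Piece → Prop := fun e => (p : ℝ) ∈ dyadicClosed e.2.2.1 e.2.2.2
  rw [lintegral_digitPrefix_comp p (fun y => (maxValue q L y : ℝ≥0∞)) s] at h
  -- The integral at `p` with every digit probability raised by `ε`: a polynomial in `ε`, at most
  -- `1` at `0`.
  let R : ℝ → ℝ := fun ε =>
    ((words s).map fun y => (y.map fun d => digitProb p d + ε).prod * maxValue q L y).sum
  have hR0 : R 0 ≤ 1 := by
    rw [← ENNReal.ofReal_le_ofReal_iff (by norm_num), ENNReal.ofReal_one]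
    refine le_trans (le_of_eq ?_) h
    have hnn : ∀ y : List Bool, 0 ≤ (y.map fun d => digitProb p d).prod := fun y =>
      List.prod_nonneg (by
        simp only [List.mem_map]; rintro _ ⟨d, -, rfl⟩; exact digitProb_nonneg p d)
    have hof : ∀ y : List Bool, ENNReal.ofReal (y.map fun d => digitProb p d).prod =
        wordProb p y := by
      intro y
      induction y with
      | nil => simp [wordProb]
      | cons d y ih =>
        simp only [List.map_cons, List.prod_cons, wordProb] at ih ⊢
        rw [ENNReal.ofReal_mul (digitProb_nonneg p d), ih]
    simp only [R, add_zero]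
    induction words s with
    | nil => simp
    | cons y l ih =>
      simp only [List.map_cons, List.sum_cons]
      rw [ENNReal.ofReal_add (mul_nonneg (hnn y) (by positivity))
        (List.sum_nonneg (by
          simp only [List.mem_map]; rintro _ ⟨y, -, rfl⟩
          exact mul_nonneg (hnn y) (by positivity))), ih,
        ENNReal.ofReal_mul (hnn y), hof, ENNReal.ofReal_natCast, mul_comm]
  have hRc : Continuous R := by
    refine continuous_list_sum _ fun y _ => ?_
    refine Continuous.mul (continuous_list_prod _ fun d _ => ?_) continuous_const
    exact continuous_const.add continuous_id
  have ht : Tendsto (fun m : ℕ => 2 * ((2 : ℝ) ^ m)⁻¹) atTop (nhds 0) := by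
    have := (tendsto_inv_atTop_zero.comp
      (tendsto_pow_atTop_atTop_of_one_lt (one_lt_two (α := ℝ)))).const_mul 2
    simpa using this
  have h1 : ∀ᶠ m : ℕ in atTop, R (2 * ((2 : ℝ) ^ m)⁻¹) < 2 :=
    ((hRc.tendsto 0).comp ht).eventually (gt_mem_nhds (by linarith))
  have h2 : ∀ᶠ m : ℕ in atTop, ∀ e ∈ L, ∀ j, (p : ℝ) ∈ dyadicOpen m j → Meets m j e → q e := by
    have : ∀ e ∈ L.toFinset, ∀ᶠ m : ℕ in atTop, ∀ j, (p : ℝ) ∈ dyadicOpen m j →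
        Meets m j e → q e := by
      rintro ⟨r, x, n, k⟩ -
      by_cases hq : q (r, x, n, k)
      · exact Eventually.of_forall fun _ _ _ _ => hq
      have hn : (0 : ℝ) < 2 ^ n := by positivity
      have hlim : Tendsto (fun m : ℕ => 2 * ((2 : ℝ) ^ m)⁻¹ * 2 ^ n) atTop (nhds 0) := by
        simpa using ht.mul_const (2 ^ n)
      -- This is `2 ^ n` times the distance from `p` to the piece's interval. It is positive because
      -- the interval is closed; an interval around `p` shorter than that distance cannot meet it.
      have hq' : 0 < max ((k : ℝ) - (p * 2 ^ n + 1)) (p * 2 ^ n - (k + 1)) := by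
        simp only [q, dyadicClosed, Set.mem_ofPred_eq, not_and_or, not_le] at hq
        rcases hq with hq | hq
        · exact lt_max_of_lt_left (by linarith)
        · exact lt_max_of_lt_right (by linarith)
      filter_upwards [hlim.eventually (gt_mem_nhds hq')] with m hm j hp hmeet
      exfalso
      obtain ⟨h3, h4⟩ := hmeet
      obtain ⟨h5, h6⟩ := hp
      have h3' : (k : ℝ) * 2 ^ m ≤ (j + 1) * 2 ^ n + 2 ^ m := by exact_mod_cast h3
      have h4' : (j : ℝ) * 2 ^ n ≤ (k + 1) * 2 ^ m + 2 ^ n := by exact_mod_cast h4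
      have hm0 : (0 : ℝ) < 2 ^ m := by positivity
      have hmul : 2 * ((2 : ℝ) ^ m)⁻¹ * 2 ^ n * 2 ^ m = 2 * 2 ^ n := by field_simp
      rcases lt_max_iff.1 hm with hm | hm
      · have := mul_lt_mul_of_pos_right hm hm0
        rw [hmul] at this
        nlinarith
      · have := mul_lt_mul_of_pos_right hm hm0
        rw [hmul] at this
        nlinarith
    filter_upwards [(Filter.eventually_all_finset L.toFinset).2 this] with m hm e he
    exact hm e (by simpa using he)
  filter_upwards [h1, h2] with m hm1 hm2 j hp
  rw [Bounded, foldr_add_eq_sum]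
  have hfin : ((((words s).map fun y => wordWeight m j y * maxValue (Meets m j) L y).sum : ℕ) : ℝ) ≤
      2 ^ (m * s) * R (2 * ((2 : ℝ) ^ m)⁻¹) := by
    simp only [R]
    rw [← List.sum_map_mul_left, Nat.cast_list_sum, List.map_map]
    refine List.sum_le_sum fun y hy => ?_
    have hw := wordWeight_le hp y
    rw [length_of_mem_words hy] at hw
    simp only [Function.comp_apply, Nat.cast_mul]
    rw [← mul_assoc]
    refine mul_le_mul hw ?_ (by positivity) (le_trans (by positivity) hw)
    exact_mod_cast maxValue_mono fun e he hmeet => hm2 e he j hp hmeet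
  have : ((((words s).map fun y => wordWeight m j y * maxValue (Meets m j) L y).sum : ℕ) : ℝ) ≤
      2 * 2 ^ (m * s) := by
    have hpos : (0 : ℝ) < 2 ^ (m * s) := by positivity
    nlinarith
  exact_mod_cast this

theorem exists_mem_dyadicOpen (p : I) (m : ℕ) : ∃ j, (p : ℝ) ∈ dyadicOpen m j := by
  have h0 : 0 ≤ (p : ℝ) * 2 ^ m := mul_nonneg p.2.1 (by positivity)
  have h1 := Nat.floor_le h0
  have h2 := Nat.lt_floor_add_one ((p : ℝ) * 2 ^ m)
  exact ⟨⌊(p : ℝ) * 2 ^ m⌋₊, by linarith, h2⟩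

/-! ### Primitive recursiveness of the check -/

section Computability

theorem primrec_pow : Primrec₂ ((· ^ ·) : ℕ → ℕ → ℕ) :=
  Primrec₂.unpaired'.1 Nat.Primrec.pow

theorem primrec_words : Primrec words := by
  have h : Primrec₂ fun (_ : ℕ) (l : List (List Bool)) =>
      l.flatMap fun w => [true :: w, false :: w] := by
    refine Primrec.list_flatMap Primrec.snd ?_
    refine Primrec.list_cons.comp (Primrec.list_cons.comp (Primrec.const true) Primrec.snd) ?_
    exact Primrec.list_cons.comp (Primrec.list_cons.comp (Primrec.const false) Primrec.snd)
      (Primrec.const [])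
  refine (Primrec.nat_rec₁ [[]] h).of_eq fun n => ?_
  induction n with
  | zero => rfl
  | succ n ih => simp only [words, ← ih]

theorem primrec_wordWeight : Primrec fun q : (ℕ × ℕ) × List Bool => wordWeight q.1.1 q.1.2 q.2 := by
  refine Primrec.list_foldr (h := fun (q : (ℕ × ℕ) × List Bool) (w : Bool × ℕ) =>
    (if w.1 then q.1.2 + 1 else 2 ^ q.1.1 + 1 - q.1.2) * w.2) Primrec.snd (Primrec.const 1) ?_
  refine Primrec.nat_mul.comp (Primrec.ite ?_ ?_ ?_) (Primrec.snd.comp Primrec.snd)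
  · exact Primrec.eq.comp (Primrec.fst.comp Primrec.snd) (Primrec.const true)
  · exact Primrec.succ.comp (Primrec.snd.comp (Primrec.fst.comp Primrec.fst))
  · exact Primrec.nat_sub.comp (Primrec.succ.comp (primrec_pow.comp (Primrec.const 2)
      (Primrec.fst.comp (Primrec.fst.comp Primrec.fst))))
      (Primrec.snd.comp (Primrec.fst.comp Primrec.fst))

theorem primrec_meets : PrimrecPred fun q : (ℕ × ℕ) × Piece => Meets q.1.1 q.1.2 q.2 := by
  have hm : Primrec fun q : (ℕ × ℕ) × Piece => 2 ^ q.1.1 :=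
    primrec_pow.comp (Primrec.const 2) (Primrec.fst.comp Primrec.fst)
  have hj : Primrec fun q : (ℕ × ℕ) × Piece => q.1.2 := Primrec.snd.comp Primrec.fst
  have hn : Primrec fun q : (ℕ × ℕ) × Piece => 2 ^ q.2.2.2.1 :=
    primrec_pow.comp (Primrec.const 2) (Primrec.fst.comp (Primrec.snd.comp
      (Primrec.snd.comp Primrec.snd)))
  have hk : Primrec fun q : (ℕ × ℕ) × Piece => q.2.2.2.2 :=
    Primrec.snd.comp (Primrec.snd.comp (Primrec.snd.comp Primrec.snd))
  exact PrimrecPred.and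
    (Primrec.nat_le.comp (Primrec.nat_mul.comp hk hm)
      (Primrec.nat_add.comp (Primrec.nat_mul.comp (Primrec.succ.comp hj) hn) hm))
    (Primrec.nat_le.comp (Primrec.nat_mul.comp hj hn)
      (Primrec.nat_add.comp (Primrec.nat_mul.comp (Primrec.succ.comp hk) hm) hn))

theorem primrec_maxValue :
    Primrec fun q : (ℕ × ℕ) × List Piece × List Bool =>
      maxValue (Meets q.1.1 q.1.2) q.2.1 q.2.2 := by
  refine Primrec.list_foldr (h := fun (q : (ℕ × ℕ) × List Piece × List Bool) (w : Piece × ℕ) =>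
    max (if Meets q.1.1 q.1.2 w.1 ∧ q.2.2.take w.1.2.1.length = w.1.2.1 then w.1.1 else 0) w.2)
    (Primrec.fst.comp Primrec.snd) (Primrec.const 0) ?_
  refine Primrec.nat_max.comp (Primrec.ite (PrimrecPred.and ?_ ?_) ?_ (Primrec.const 0))
    (Primrec.snd.comp Primrec.snd)
  · exact primrec_meets.comp (Primrec.pair (Primrec.fst.comp Primrec.fst)
      (Primrec.fst.comp Primrec.snd))
  · have hx : Primrec fun q : ((ℕ × ℕ) × List Piece × List Bool) × Piece × ℕ => q.2.1.2.1 :=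
      Primrec.fst.comp (Primrec.snd.comp (Primrec.fst.comp Primrec.snd))
    exact Primrec.eq.comp (Primrec.list_take.comp (Primrec.list_length.comp hx)
      (Primrec.snd.comp (Primrec.snd.comp Primrec.fst))) hx
  · exact Primrec.fst.comp (Primrec.fst.comp Primrec.snd)

theorem primrec_bounded :
    PrimrecPred fun q : (List Piece × ℕ) × ℕ × ℕ => Bounded q.1.1 q.1.2 q.2.1 q.2.2 := by
  refine Primrec.nat_le.comp (Primrec.list_foldr
    (h := fun (q : (List Piece × ℕ) × ℕ × ℕ) (w : List Bool × ℕ) =>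
      wordWeight q.2.1 q.2.2 w.1 * maxValue (Meets q.2.1 q.2.2) q.1.1 w.1 + w.2)
    (primrec_words.comp (Primrec.snd.comp Primrec.fst)) (Primrec.const 0) ?_) ?_
  · refine Primrec.nat_add.comp (Primrec.nat_mul.comp ?_ ?_) (Primrec.snd.comp Primrec.snd)
    · exact primrec_wordWeight.comp (Primrec.pair (Primrec.snd.comp Primrec.fst)
        (Primrec.fst.comp Primrec.snd))
    · exact primrec_maxValue.comp (Primrec.pair (Primrec.snd.comp Primrec.fst)
        (Primrec.pair (Primrec.fst.comp (Primrec.fst.comp Primrec.fst))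
          (Primrec.fst.comp Primrec.snd)))
  · exact Primrec.nat_mul.comp (Primrec.const 2) (primrec_pow.comp (Primrec.const 2)
      (Primrec.nat_mul.comp (Primrec.fst.comp Primrec.snd) (Primrec.snd.comp Primrec.fst)))

end Computability

end BernoulliTests

/-! ### Codes of rationals and dyadic intervals -/

namespace BernoulliTests

open Encodable
open Nat.Partrec (Code)
open Nat.Partrec.Code (evaln)

section Rationals

theorem ratOf_lt_iff {r r' : RatCode} : ratOf r < ratOf r' ↔
    r.1 * (r'.2.2 + 1) + r'.2.1 * (r.2.2 + 1) < r'.1 * (r.2.2 + 1) + r.2.1 * (r'.2.2 + 1) := by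
  obtain ⟨a, b, c⟩ := r
  obtain ⟨a', b', c'⟩ := r'
  have hc : (0 : ℚ) < c + 1 := by positivity
  have hc' : (0 : ℚ) < c' + 1 := by positivity
  simp only [ratOf]
  rw [div_lt_div_iff₀ hc hc', ← Nat.cast_lt (α := ℚ)]
  push_cast
  constructor <;> intro h <;> linarith

theorem primrec_ratOf_lt : PrimrecRel fun r r' : RatCode => ratOf r < ratOf r' := by
  have h1 : Primrec fun q : RatCode × RatCode => q.1.1 := Primrec.fst.comp Primrec.fst
  have h2 : Primrec fun q : RatCode × RatCode => q.1.2.1 :=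
    Primrec.fst.comp (Primrec.snd.comp Primrec.fst)
  have h3 : Primrec fun q : RatCode × RatCode => q.1.2.2 + 1 :=
    Primrec.succ.comp (Primrec.snd.comp (Primrec.snd.comp Primrec.fst))
  have h4 : Primrec fun q : RatCode × RatCode => q.2.1 := Primrec.fst.comp Primrec.snd
  have h5 : Primrec fun q : RatCode × RatCode => q.2.2.1 :=
    Primrec.fst.comp (Primrec.snd.comp Primrec.snd)
  have h6 : Primrec fun q : RatCode × RatCode => q.2.2.2 + 1 :=
    Primrec.succ.comp (Primrec.snd.comp (Primrec.snd.comp Primrec.snd))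
  exact (Primrec.nat_lt.comp
    (Primrec.nat_add.comp (Primrec.nat_mul.comp h1 h6) (Primrec.nat_mul.comp h5 h3))
    (Primrec.nat_add.comp (Primrec.nat_mul.comp h4 h3) (Primrec.nat_mul.comp h2 h6))).of_eq
      fun q => ratOf_lt_iff.symm

theorem exists_ratOf_eq (q : ℚ) : ∃ r, ratOf r = q := by
  refine ⟨(q.num.toNat, (-q.num).toNat, q.den - 1), ?_⟩
  have h1 : ((q.num.toNat : ℚ) - ((-q.num).toNat : ℚ)) = (q.num : ℚ) := by
    have := Int.toNat_sub_toNat_neg q.num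
    exact_mod_cast this
  have h2 : ((q.den - 1 : ℕ) : ℚ) + 1 = q.den := by
    have := q.den_pos
    rw [Nat.cast_sub this]; simp
  simp only [ratOf]
  rw [h1, h2, Rat.num_div_den]

/-- A code of `a / 2 ^ m`. -/
def dyadicCode (a m : ℕ) : RatCode := (a, 0, 2 ^ m - 1)

/-- A code of the left end `(j - 1) / 2 ^ m` of `dyadicOpen m j`. -/
def leftCode (m j : ℕ) : RatCode := (j, 1, 2 ^ m - 1)

/-- A code of the right end `(j + 1) / 2 ^ m` of `dyadicOpen m j`. -/
def rightCode (m j : ℕ) : RatCode := dyadicCode (j + 1) m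

theorem two_pow_sub_one_add_one (m : ℕ) : ((2 ^ m - 1 : ℕ) : ℚ) + 1 = 2 ^ m := by
  rw [Nat.cast_sub Nat.one_le_two_pow]; simp

theorem ratOf_dyadicCode (a m : ℕ) : (ratOf (dyadicCode a m) : ℝ) = a / 2 ^ m := by
  simp only [ratOf, dyadicCode, two_pow_sub_one_add_one]; simp

theorem ratOf_leftCode (m j : ℕ) : (ratOf (leftCode m j) : ℝ) = (j - 1) / 2 ^ m := by
  simp only [ratOf, leftCode, two_pow_sub_one_add_one]; simp

theorem ratOf_rightCode (m j : ℕ) : (ratOf (rightCode m j) : ℝ) = (j + 1) / 2 ^ m := by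
  rw [rightCode, ratOf_dyadicCode]; simp

theorem primrec_dyadicCode : Primrec₂ dyadicCode :=
  Primrec.pair Primrec.fst (Primrec.pair (Primrec.const 0)
    (Primrec.nat_sub.comp (primrec_pow.comp (Primrec.const 2) Primrec.snd) (Primrec.const 1)))

theorem primrec_leftCode : Primrec₂ leftCode :=
  Primrec.pair Primrec.snd (Primrec.pair (Primrec.const 1)
    (Primrec.nat_sub.comp (primrec_pow.comp (Primrec.const 2) Primrec.fst) (Primrec.const 1)))

theorem primrec_rightCode : Primrec₂ rightCode :=
  primrec_dyadicCode.comp (Primrec.succ.comp Primrec.snd) Primrec.fst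

theorem mem_dyadicOpen_iff {m j : ℕ} {p : ℝ} : p ∈ dyadicOpen m j ↔
    (ratOf (leftCode m j) : ℝ) < p ∧ p < ratOf (rightCode m j) := by
  rw [ratOf_leftCode, ratOf_rightCode, div_lt_iff₀ (by positivity), lt_div_iff₀ (by positivity)]
  exact and_congr_left' sub_lt_iff_lt_add.symm

theorem mem_dyadicClosed_iff {m j : ℕ} {p : ℝ} : p ∈ dyadicClosed m j ↔
    (ratOf (leftCode m j) : ℝ) ≤ p ∧ p ≤ ratOf (rightCode m j) := by
  rw [ratOf_leftCode, ratOf_rightCode, div_le_iff₀ (by positivity), le_div_iff₀ (by positivity)]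
  exact and_congr_left' sub_le_iff_le_add.symm

open Filter in
-- The dyadic interval has length `2 * (2 ^ m)⁻¹`, eventually less than the distances from `p` to
-- `a` and `b`.
theorem eventually_dyadic_subset {a b p : ℝ} (ha : a < p) (hb : p < b) :
    ∀ᶠ m in atTop, ∀ j, p ∈ dyadicClosed m j →
      a < ratOf (leftCode m j) ∧ (ratOf (rightCode m j) : ℝ) < b := by
  have ht : Tendsto (fun m : ℕ => 2 * ((2 : ℝ) ^ m)⁻¹) atTop (nhds 0) := by
    have := (tendsto_inv_atTop_zero.comp
      (tendsto_pow_atTop_atTop_of_one_lt (one_lt_two (α := ℝ)))).const_mul 2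
    simpa using this
  filter_upwards [ht.eventually (gt_mem_nhds (sub_pos.2 ha)),
    ht.eventually (gt_mem_nhds (sub_pos.2 hb))] with m h1 h2 j hp
  rw [mem_dyadicClosed_iff] at hp
  have : (ratOf (rightCode m j) : ℝ) - ratOf (leftCode m j) = 2 * ((2 : ℝ) ^ m)⁻¹ := by
    rw [ratOf_leftCode, ratOf_rightCode]; ring
  constructor <;> linarith

theorem coe_lt_coe_ennreal_iff {r : ℝ} {x : ℝ≥0∞} :
    ((r : EReal) < (x : EReal)) ↔ r < 0 ∨ ENNReal.ofReal r < x := by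
  rcases lt_or_ge r 0 with h | h
  · simp only [h, true_or, iff_true]
    exact lt_of_lt_of_le (by exact_mod_cast h) (EReal.coe_ennreal_nonneg x)
  · have : (r : EReal) = ((ENNReal.ofReal r : ℝ≥0∞) : EReal) := by
      rw [EReal.coe_ennreal_ofReal, max_eq_left h]
    rw [this, EReal.coe_ennreal_lt_coe_ennreal_iff]
    simp [not_lt.2 h]

theorem coe_lt_natCast_mul_iff {r : RatCode} {a m : ℕ} :
    ((ratOf r : ℝ) : EReal) < (((a : ℝ≥0∞) * 2⁻¹ ^ m : ℝ≥0∞) : EReal) ↔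
      ratOf r < ratOf (dyadicCode a m) := by
  have : ((a : ℝ≥0∞) * 2⁻¹ ^ m) = ENNReal.ofReal (ratOf (dyadicCode a m) : ℝ) := by
    rw [ratOf_dyadicCode, ENNReal.ofReal_div_of_pos (by positivity), ENNReal.ofReal_natCast,
      ENNReal.ofReal_pow (by norm_num), div_eq_mul_inv, ENNReal.inv_pow]
    simp
  have h0 : (0 : ℝ) ≤ ratOf (dyadicCode a m) := by rw [ratOf_dyadicCode]; positivity
  rw [this, EReal.coe_ennreal_ofReal, max_eq_left h0, EReal.coe_lt_coe_iff, Rat.cast_lt]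

end Rationals

/-! ### The universal uniform test -/

/-- The pieces that are accepted within `s` steps by the `c`-th program. -/
def stage (c s : ℕ) : List Piece :=
  (List.range s).filterMap fun i => (decode (α := Piece) i).bind fun e =>
    if (evaln s (Denumerable.ofNat Code c) (encode e)).isSome = true ∧ e.2.1.length ≤ s
    then some e else none

/-- Scanning codes below `s` misses nothing, since `evaln s` accepts only inputs below `s`. The
bound on the word length makes the first `s` digits decide every piece of the stage. -/
theorem mem_stage {c s : ℕ} {e : Piece} : e ∈ stage c s ↔
    (evaln s (Denumerable.ofNat Code c) (encode e)).isSome = true ∧ e.2.1.length ≤ s := by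
  simp only [stage, List.mem_filterMap, List.mem_range, Option.bind_eq_some_iff]
  constructor
  · rintro ⟨i, -, e', -, h⟩
    split_ifs at h with h'
    obtain rfl : e' = e := by simpa using h
    exact h'
  · intro h
    obtain ⟨y, hy⟩ := Option.isSome_iff_exists.1 h.1
    exact ⟨encode e, Nat.Partrec.Code.evaln_bound hy, e, encodek e, if_pos h⟩

theorem stage_mono {c s t : ℕ} (h : s ≤ t) {e : Piece} (he : e ∈ stage c s) : e ∈ stage c t := by
  rw [mem_stage] at he ⊢
  obtain ⟨y, hy⟩ := Option.isSome_iff_exists.1 he.1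
  exact ⟨Option.isSome_iff_exists.2 ⟨y, Nat.Partrec.Code.evaln_mono h hy⟩, he.2.trans h⟩

theorem primrec_stage : Primrec₂ stage := by
  refine Primrec.listFilterMap (Primrec.list_range.comp Primrec.snd) ?_
  refine Primrec.option_bind (Primrec.decode.comp Primrec.snd) ?_
  have hs : Primrec fun w : ((ℕ × ℕ) × ℕ) × Piece => w.1.1.2 :=
    Primrec.snd.comp (Primrec.fst.comp Primrec.fst)
  refine Primrec.ite (PrimrecPred.and ?_ ?_) (Primrec.option_some.comp Primrec.snd)
    (Primrec.const none)
  · refine Primrec.eq.comp (Primrec.option_isSome.comp (Nat.Partrec.Code.primrec_evaln.comp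
      (Primrec.pair (Primrec.pair hs ?_) (Primrec.encode.comp Primrec.snd)))) (Primrec.const true)
    exact (Primrec.ofNat Code).comp (Primrec.fst.comp (Primrec.fst.comp Primrec.fst))
  · exact Primrec.nat_le.comp (Primrec.list_length.comp (Primrec.fst.comp
      (Primrec.snd.comp Primrec.snd))) hs

theorem exists_forall_mem_stage {S : Piece → Prop} (hS : REPred S) :
    ∃ c, (∀ s, ∀ e ∈ stage c s, S e) ∧ ∀ e, S e → ∃ s, e ∈ stage c s := by
  obtain ⟨C, hC⟩ := Nat.Partrec.Code.exists_code.1 hS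
  have h1 : ∀ e, S e ↔ ∃ s, (evaln s C (encode e)).isSome = true := by
    intro e
    have h1 : S e ↔ (Nat.Partrec.Code.eval C (encode e)).Dom := by
      rw [hC]
      simp only [encodek, Part.coe_some, Part.bind_some]
      constructor
      · intro h; exact ⟨h, trivial⟩
      · rintro ⟨h, -⟩; exact h
    rw [h1, Part.dom_iff_mem]
    simp only [Nat.Partrec.Code.evaln_complete, Option.isSome_iff_exists, Option.mem_def]
    exact exists_comm
  refine ⟨encode C, fun s e he => ?_, fun e he => ?_⟩
  · rw [mem_stage, Denumerable.ofNat_encode] at he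
    exact (h1 e).2 ⟨s, he.1⟩
  · obtain ⟨s, hs⟩ := (h1 e).1 he
    refine ⟨max s e.2.1.length, mem_stage.2 ⟨?_, le_max_right _ _⟩⟩
    obtain ⟨y, hy⟩ := Option.isSome_iff_exists.1 hs
    rw [Denumerable.ofNat_encode]
    exact Option.isSome_iff_exists.2 ⟨y, Nat.Partrec.Code.evaln_mono (le_max_left _ _) hy⟩

/-- In the tuple `(c, s, e, m, j)` the piece `e` is accepted by the `c`-th program within `s`
steps, and its restriction to `dyadicOpen m j` keeps the integrals bounded. -/
def Admissible (w : ℕ × ℕ × Piece × ℕ × ℕ) : Prop :=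
  w.2.2.1 ∈ stage w.1 w.2.1 ∧ Bounded (stage w.1 w.2.1) w.2.1 w.2.2.2.1 w.2.2.2.2 ∧
    ¬ ratOf (leftCode w.2.2.2.1 w.2.2.2.2) < ratOf (leftCode w.2.2.1.2.2.1 w.2.2.1.2.2.2) ∧
    ¬ ratOf (rightCode w.2.2.1.2.2.1 w.2.2.1.2.2.2) < ratOf (rightCode w.2.2.2.1 w.2.2.2.2)

theorem primrec_admissible : PrimrecPred Admissible := by
  have hc : Primrec fun w : ℕ × ℕ × Piece × ℕ × ℕ => w.1 := Primrec.fst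
  have hs : Primrec fun w : ℕ × ℕ × Piece × ℕ × ℕ => w.2.1 := Primrec.fst.comp Primrec.snd
  have he : Primrec fun w : ℕ × ℕ × Piece × ℕ × ℕ => w.2.2.1 :=
    Primrec.fst.comp (Primrec.snd.comp Primrec.snd)
  have hmj : Primrec fun w : ℕ × ℕ × Piece × ℕ × ℕ => w.2.2.2 :=
    Primrec.snd.comp (Primrec.snd.comp Primrec.snd)
  have hnk : Primrec fun w : ℕ × ℕ × Piece × ℕ × ℕ => w.2.2.1.2.2 :=
    Primrec.snd.comp (Primrec.snd.comp he)
  have hst := primrec_stage.comp hc hs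
  have hmem : PrimrecRel fun (L : List Piece) (e : Piece) => ∃ a ∈ L, a = e :=
    PrimrecRel.exists_mem_list Primrec.eq
  have h1 : PrimrecPred fun w : ℕ × ℕ × Piece × ℕ × ℕ => w.2.2.1 ∈ stage w.1 w.2.1 :=
    (hmem.comp hst he).of_eq fun w => by simp
  have h2 : PrimrecPred fun w : ℕ × ℕ × Piece × ℕ × ℕ =>
      Bounded (stage w.1 w.2.1) w.2.1 w.2.2.2.1 w.2.2.2.2 :=
    PrimrecPred.comp (f := fun w : ℕ × ℕ × Piece × ℕ × ℕ => ((stage w.1 w.2.1, w.2.1), w.2.2.2))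
      primrec_bounded (Primrec.pair (Primrec.pair hst hs) hmj)
  have h3 : PrimrecPred fun w : ℕ × ℕ × Piece × ℕ × ℕ =>
      ratOf (leftCode w.2.2.2.1 w.2.2.2.2) < ratOf (leftCode w.2.2.1.2.2.1 w.2.2.1.2.2.2) :=
    primrec_ratOf_lt.comp
      (primrec_leftCode.comp (Primrec.fst.comp hmj) (Primrec.snd.comp hmj))
      (primrec_leftCode.comp (Primrec.fst.comp hnk) (Primrec.snd.comp hnk))
  have h4 : PrimrecPred fun w : ℕ × ℕ × Piece × ℕ × ℕ =>
      ratOf (rightCode w.2.2.1.2.2.1 w.2.2.1.2.2.2) < ratOf (rightCode w.2.2.2.1 w.2.2.2.2) :=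
    primrec_ratOf_lt.comp
      (primrec_rightCode.comp (Primrec.fst.comp hnk) (Primrec.snd.comp hnk))
      (primrec_rightCode.comp (Primrec.fst.comp hmj) (Primrec.snd.comp hmj))
  exact h1.and (h2.and (h3.not.and h4.not))

theorem Admissible.mem_dyadicClosed {w : ℕ × ℕ × Piece × ℕ × ℕ} (hw : Admissible w) {p : ℝ}
    (hp : p ∈ dyadicOpen w.2.2.2.1 w.2.2.2.2) :
    p ∈ dyadicClosed w.2.2.1.2.2.1 w.2.2.1.2.2.2 := by
  rw [mem_dyadicOpen_iff] at hp
  have h1 : (ratOf (leftCode w.2.2.1.2.2.1 w.2.2.1.2.2.2) : ℝ) ≤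
      ratOf (leftCode w.2.2.2.1 w.2.2.2.2) := by exact_mod_cast not_lt.1 hw.2.2.1
  have h2 : (ratOf (rightCode w.2.2.2.1 w.2.2.2.2) : ℝ) ≤
      ratOf (rightCode w.2.2.1.2.2.1 w.2.2.1.2.2.2) := by exact_mod_cast not_lt.1 hw.2.2.2
  exact mem_dyadicClosed_iff.2 ⟨h1.trans hp.1.le, hp.2.le.trans h2⟩

/-- The weighted supremum of all admissible pieces. -/
noncomputable def universalTest (z : Omega × I) : ℝ≥0∞ :=
  max 2⁻¹ (⨆ (w : ℕ × ℕ × Piece × ℕ × ℕ) (_ : Admissible w ∧ z.1 ∈ wordCylinder w.2.2.1.2.1 ∧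
    (z.2 : ℝ) ∈ dyadicOpen w.2.2.2.1 w.2.2.2.2), (w.2.2.1.1 : ℝ≥0∞) * 2⁻¹ ^ (w.1 + 3))

theorem coe_lt_universalTest_iff {r : RatCode} {z : Omega × I} :
    ((ratOf r : ℝ) : EReal) < ((universalTest z : ℝ≥0∞) : EReal) ↔
      ratOf r < ratOf (dyadicCode 1 1) ∨ ∃ w : ℕ × ℕ × Piece × ℕ × ℕ, (Admissible w ∧
        z.1 ∈ wordCylinder w.2.2.1.2.1 ∧ (z.2 : ℝ) ∈ dyadicOpen w.2.2.2.1 w.2.2.2.2) ∧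
        ratOf r < ratOf (dyadicCode w.2.2.1.1 (w.1 + 3)) := by
  simp only [← coe_lt_natCast_mul_iff]
  simp only [coe_lt_coe_ennreal_iff, universalTest, lt_max_iff, lt_iSup_iff]
  simp only [Nat.cast_one, one_mul, pow_one, exists_prop]
  constructor
  · rintro (h | h | ⟨w, hw, h⟩)
    · exact .inl (.inl h)
    · exact .inl (.inr h)
    · exact .inr ⟨w, hw, .inr h⟩
  · rintro ((h | h) | ⟨w, hw, h | h⟩)
    · exact .inl h
    · exact .inr (.inl h)
    · exact .inl h
    · exact .inr (.inr ⟨w, hw, h⟩)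

theorem lowerSemicomputable_universalTest :
    LowerSemicomputable ∅ rectangle universalTest := by
  -- The codes `(0, 1, 0)` and `(2, 0, 0)` stand for `-1` and `2`, so this rectangle is the whole
  -- space; it accounts for the floor `2⁻¹`.
  refine ⟨fun q => (ratOf q.1 < ratOf (dyadicCode 1 1) ∧ q.2 = ([], (0, 1, 0), (2, 0, 0))) ∨
    ∃ w : ℕ × ℕ × Piece × ℕ × ℕ, Admissible w ∧
      q.2 = (w.2.2.1.2.1, leftCode w.2.2.2.1 w.2.2.2.2, rightCode w.2.2.2.1 w.2.2.2.2) ∧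
      ratOf q.1 < ratOf (dyadicCode w.2.2.1.1 (w.1 + 3)), ?_, ?_⟩
  · rw [rePredIn_empty]
    refine REPred.or (PrimrecPred.rePred ?_) (REPred.exists (PrimrecPred.rePred ?_))
    · exact PrimrecPred.and (primrec_ratOf_lt.comp Primrec.fst (Primrec.const _))
        (Primrec.eq.comp Primrec.snd (Primrec.const _))
    · have hmj : Primrec fun w : (RatCode × List Bool × RatCode × RatCode) ×
          (ℕ × ℕ × Piece × ℕ × ℕ) => w.2.2.2.2 :=
        Primrec.snd.comp (Primrec.snd.comp (Primrec.snd.comp Primrec.snd))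
      have he : Primrec fun w : (RatCode × List Bool × RatCode × RatCode) ×
          (ℕ × ℕ × Piece × ℕ × ℕ) => w.2.2.2.1 :=
        Primrec.fst.comp (Primrec.snd.comp (Primrec.snd.comp Primrec.snd))
      refine PrimrecPred.and (primrec_admissible.comp Primrec.snd) (PrimrecPred.and ?_ ?_)
      · refine Primrec.eq.comp (Primrec.snd.comp Primrec.fst) (Primrec.pair
          (Primrec.fst.comp (Primrec.snd.comp he)) (Primrec.pair ?_ ?_))
        · exact primrec_leftCode.comp (Primrec.fst.comp hmj) (Primrec.snd.comp hmj)
        · exact primrec_rightCode.comp (Primrec.fst.comp hmj) (Primrec.snd.comp hmj)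
      · exact primrec_ratOf_lt.comp (Primrec.fst.comp Primrec.fst)
          (primrec_dyadicCode.comp (Primrec.fst.comp he)
            (Primrec.nat_add.comp (Primrec.fst.comp Primrec.snd) (Primrec.const 3)))
  · intro r
    ext z
    simp only [Set.mem_ofPred_eq]
    rw [coe_lt_universalTest_iff]
    constructor
    · rintro (h | ⟨w, ⟨h1, h2, h3⟩, h4⟩)
      · refine ⟨_, .inl ⟨h, rfl⟩, ?_, ?_, ?_⟩
        · intro i; exact i.elim0
        · have := z.2.2.1
          norm_num [ratOf]; linarith
        · have := z.2.2.2
          norm_num [ratOf]; linarith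
      · refine ⟨_, .inr ⟨w, h1, rfl, h4⟩, h2, ?_⟩
        exact mem_dyadicOpen_iff.1 h3
    · rintro ⟨a, ⟨h, -⟩ | ⟨w, h1, rfl, h4⟩, ha⟩
      · exact .inl h
      · exact .inr ⟨w, ⟨h1, ha.1, mem_dyadicOpen_iff.2 ha.2⟩, h4⟩

open Classical in
theorem cast_maxValue_le {q : Piece → Prop} {L : List Piece} {y : List Bool}
    {v : ℝ≥0∞} (h : ∀ e ∈ L, q e → e.2.1 <+: y → (e.1 : ℝ≥0∞) ≤ v) :
    (maxValue q L y : ℝ≥0∞) ≤ v := by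
  unfold maxValue
  induction L with
  | nil => simp
  | cons e L ih =>
    simp only [List.mem_cons, forall_eq_or_imp] at h
    rw [List.foldr_cons, Nat.mono_cast.map_max]
    refine max_le ?_ (ih h.2)
    split_ifs with h'
    · exact h.1 h'.1 (List.prefix_iff_eq_take.2 h'.2.symm)
    · simp

open Classical in
/-- The maximum on `(ω, p)` of the pieces accepted by the `c`-th program within `s` steps. -/
noncomputable def stageValue (p : I) (c s : ℕ) (ω : Omega) : ℝ≥0∞ :=
  (maxValue (fun e => (p : ℝ) ∈ dyadicClosed e.2.2.1 e.2.2.2) (stage c s) (digitPrefix ω s) : ℝ≥0∞)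

theorem stageValue_mono (p : I) (c : ℕ) (ω : Omega) : Monotone fun s => stageValue p c s ω := by
  classical
  intro s t h
  refine cast_maxValue_le fun e he hq hy => ?_
  refine Nat.cast_le.2 (le_maxValue (stage_mono h he) hq ?_)
  rw [prefix_digitPrefix_iff] at hy ⊢
  exact ⟨hy.1.trans h, hy.2⟩

theorem lintegral_universalTest_le (p : I) :
    ∫⁻ ω, universalTest (ω, p) ∂(bernoulliProd p) ≤ 1 := by
  classical
  -- The stages that pass the check on some interval around `p`. They need not form an initial
  -- segment, but stage values increase with `s`, so monotone convergence keeps the bound `2` for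
  -- their supremum.
  let A : ℕ → Set ℕ := fun c => {s | ∃ m j, (p : ℝ) ∈ dyadicOpen m j ∧ Bounded (stage c s) s m j}
  let h : ℕ → Omega → ℝ≥0∞ := fun c ω => ⨆ s : A c, stageValue p c s ω
  have hmeas : ∀ c s, Measurable (stageValue p c s) := fun c s =>
    measurable_digitPrefix_comp (fun y =>
      (maxValue (fun e => (p : ℝ) ∈ dyadicClosed e.2.2.1 e.2.2.2) (stage c s) y : ℝ≥0∞)) s
  have hhm : ∀ c, Measurable (h c) := fun c => Measurable.iSup fun s => hmeas c s
  have hh : ∀ c, ∫⁻ ω, h c ω ∂(bernoulliProd p) ≤ 2 := by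
    intro c
    simp only [h]
    rw [lintegral_iSup_directed (fun s : A c => (hmeas c s).aemeasurable)]
    · refine iSup_le fun ⟨s, m, j, hp, hb⟩ => hb.lintegral_le hp
    · refine directed_of_isDirected_le ?_
      intro s t hst ω
      exact stageValue_mono p c ω hst
  -- The weights are chosen so that the integral of the sum is at most `2⁻¹`, leaving exactly `2⁻¹`
  -- for the floor.
  have hle : ∀ ω, universalTest (ω, p) ≤ 2⁻¹ + ∑' c, 2⁻¹ ^ (c + 3) * h c ω := by
    intro ω
    refine max_le le_self_add (iSup₂_le fun w hw => ?_)
    refine le_trans ?_ le_add_self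
    refine le_trans ?_ (ENNReal.le_tsum w.1)
    rw [mul_comm]
    gcongr
    obtain ⟨h1, h2, h3⟩ := hw
    refine le_trans ?_ (le_iSup (fun s : A w.1 => stageValue p w.1 s ω)
      ⟨w.2.1, _, _, h3, h1.2.1⟩)
    refine Nat.cast_le.2 (le_maxValue h1.1 (h1.mem_dyadicClosed h3) ?_)
    rw [prefix_digitPrefix_iff]
    exact ⟨(mem_stage.1 h1.1).2, h2⟩
  calc ∫⁻ ω, universalTest (ω, p) ∂(bernoulliProd p)
      ≤ ∫⁻ ω, (2⁻¹ + ∑' c, 2⁻¹ ^ (c + 3) * h c ω) ∂(bernoulliProd p) := lintegral_mono hle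
    _ = 2⁻¹ + ∑' c, 2⁻¹ ^ (c + 3) * ∫⁻ ω, h c ω ∂(bernoulliProd p) := by
        rw [lintegral_add_left measurable_const, lintegral_const, measure_univ, mul_one,
          lintegral_tsum fun c => ((hhm c).const_mul _).aemeasurable]
        congr 2
        ext c
        rw [lintegral_const_mul _ (hhm c)]
    _ ≤ 2⁻¹ + ∑' c : ℕ, 2⁻¹ ^ (c + 3) * 2 := by
        gcongr with c
        exact hh c
    _ = 1 := by
        have : ∀ c : ℕ, (2⁻¹ : ℝ≥0∞) ^ (c + 3) * 2 = 2⁻¹ ^ c * (2⁻¹ * 2⁻¹) := by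
          intro c
          rw [pow_add, mul_assoc, pow_succ, mul_assoc (2⁻¹ ^ 2),
            ENNReal.inv_mul_cancel (by norm_num) (by norm_num), mul_one, pow_two]
        simp only [this]
        rw [ENNReal.tsum_mul_right, ENNReal.tsum_geometric, ENNReal.one_sub_inv_two, inv_inv,
          ← mul_assoc, ENNReal.mul_inv_cancel (by norm_num) (by norm_num), one_mul,
          ENNReal.inv_two_add_inv_two]

theorem isUniformBernoulliTest_universalTest : IsUniformBernoulliTest universalTest :=
  ⟨lowerSemicomputable_universalTest, lintegral_universalTest_le⟩

/-- This floor absorbs the error made by rounding the values of tests to natural numbers. -/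
theorem inv_two_le_universalTest (z : Omega × I) : 2⁻¹ ≤ universalTest z := le_max_left _ _

/-- An enumerable family of pieces is dominated by `universalTest` at each parameter `p` where a
function of `B_p`-integral at most `1` majorizes it. -/
theorem exists_le_mul_universalTest {S : Piece → Prop} (hS : REPred S) :
    ∃ C : ℝ≥0, ∀ (p : I) (g : Omega → ℝ≥0∞), ∫⁻ ω, g ω ∂(bernoulliProd p) ≤ 1 →
      (∀ ω e, S e → (p : ℝ) ∈ dyadicClosed e.2.2.1 e.2.2.2 → ω ∈ wordCylinder e.2.1 →
        (e.1 : ℝ≥0∞) ≤ g ω) →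
      ∀ ω e, S e → (p : ℝ) ∈ dyadicOpen e.2.2.1 e.2.2.2 → ω ∈ wordCylinder e.2.1 →
        (e.1 : ℝ≥0∞) ≤ C * universalTest (ω, p) := by
  classical
  obtain ⟨c, hc1, hc2⟩ := exists_forall_mem_stage hS
  refine ⟨2 ^ (c + 3), fun p g hg hSg ω e he hp hω => ?_⟩
  obtain ⟨s, hs⟩ := hc2 e he
  -- At `p` the whole stage lies below `g`, so it passes the check on all small intervals around
  -- `p`; one of these also fits inside the interval of `e`.
  have hInt : ∫⁻ ω, stageValue p c s ω ∂(bernoulliProd p) ≤ 1 := by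
    refine le_trans (lintegral_mono fun ω => ?_) hg
    refine cast_maxValue_le fun e he hq hy => ?_
    exact hSg ω e (hc1 s e he) hq (prefix_digitPrefix_iff.1 hy).2
  rw [mem_dyadicOpen_iff] at hp
  obtain ⟨m, hm1, hm2⟩ := ((eventually_bounded hInt).and
    (eventually_dyadic_subset hp.1 hp.2)).exists
  obtain ⟨j, hj⟩ := exists_mem_dyadicOpen p m
  have hsub := hm2 j (dyadicOpen_subset_dyadicClosed _ _ hj)
  have hadm : Admissible (c, s, e, m, j) := by
    refine ⟨hs, hm1 j hj, ?_, ?_⟩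
    · exact not_lt.2 (by exact_mod_cast hsub.1.le)
    · exact not_lt.2 (by exact_mod_cast hsub.2.le)
  have hle : (e.1 : ℝ≥0∞) * 2⁻¹ ^ (c + 3) ≤ universalTest (ω, p) :=
    le_max_of_le_right (le_iSup₂_of_le (c, s, e, m, j) ⟨hadm, hω, hj⟩ le_rfl)
  calc (e.1 : ℝ≥0∞) = 2 ^ (c + 3) * (e.1 * 2⁻¹ ^ (c + 3)) := by
        rw [mul_left_comm, ← mul_pow, ENNReal.mul_inv_cancel (by norm_num) (by norm_num), one_pow,
          mul_one]
    _ ≤ ((2 ^ (c + 3) : ℝ≥0) : ℝ≥0∞) * universalTest (ω, p) := by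
        push_cast
        gcongr

end BernoulliTests

/-! ### Comparison of tests up to constants -/

namespace BernoulliTests

open Encodable

theorem DominatedBy.trans {X : Type} {f g h : X → ℝ≥0∞} (hfg : DominatedBy f g)
    (hgh : DominatedBy g h) : DominatedBy f h := by
  obtain ⟨c, hc⟩ := hfg
  obtain ⟨d, hd⟩ := hgh
  refine ⟨c * d, fun x => (hc x).trans ?_⟩
  rw [ENNReal.coe_mul, mul_assoc]
  gcongr
  exact hd x

theorem DominatedBy.lt_top {X : Type} {f g : X → ℝ≥0∞} (h : DominatedBy f g) {x : X}
    (hx : g x < ∞) : f x < ∞ := by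
  obtain ⟨c, hc⟩ := h
  exact (hc x).trans_lt (ENNReal.mul_lt_top ENNReal.coe_lt_top hx)

theorem IsUniversal.eqUpToConst {X : Type} {P : (X → ℝ≥0∞) → Prop} {u v : X → ℝ≥0∞}
    (hu : IsUniversal P u) (hv : IsUniversal P v) : EqUpToConst u v :=
  ⟨hv.2 u hu.1, hu.2 v hv.1⟩

/-- Natural levels determine `t` up to an additive `1`, and `1 ≤ 2 * u`. -/
theorem le_mul_of_forall_natCast {t u : ℝ≥0∞} {C : ℝ≥0} (hu : 2⁻¹ ≤ u)
    (h : ∀ r : ℕ, (r : ℝ≥0∞) < t → (r : ℝ≥0∞) ≤ C * u) : t ≤ ((C + 2 : ℝ≥0) : ℝ≥0∞) * u := by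
  have h1 : t ≤ C * u + 1 := by
    by_contra! hlt
    have hfin : (C : ℝ≥0∞) * u ≠ ∞ := fun htop => by simp [htop] at hlt
    lift (C : ℝ≥0∞) * u to ℝ≥0 using hfin with v
    have h2 : ((⌊v⌋₊ + 1 : ℕ) : ℝ≥0∞) < t := by
      refine lt_of_le_of_lt ?_ hlt
      have : ((⌊v⌋₊ + 1 : ℕ) : ℝ≥0) ≤ v + 1 := by
        push_cast; gcongr; exact Nat.floor_le (by positivity)
      exact_mod_cast this
    have h3 : ((⌊v⌋₊ + 1 : ℕ) : ℝ≥0) ≤ v := by exact_mod_cast h _ h2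
    have h4 := Nat.lt_floor_add_one v
    push_cast at h3
    exact absurd h3 (not_le.2 h4)
  refine h1.trans ?_
  push_cast
  rw [add_mul]
  gcongr
  calc (1 : ℝ≥0∞) = 2 * 2⁻¹ := (ENNReal.mul_inv_cancel (by norm_num) (by norm_num)).symm
    _ ≤ 2 * u := by gcongr

theorem coe_natCode_lt_iff {r : ℕ} {x : ℝ≥0∞} :
    ((ratOf (r, 0, 0) : ℝ) : EReal) < (x : EReal) ↔ (r : ℝ≥0∞) < x := by
  have : (ratOf (r, 0, 0) : ℝ) = r := by simp [ratOf]
  rw [this, coe_lt_coe_ennreal_iff, ENNReal.ofReal_natCast]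
  simp

/-! ### Universality among uniform tests -/

section Uniform

theorem primrec_natCode : Primrec fun r : ℕ => ((r, 0, 0) : RatCode) :=
  Primrec.pair Primrec.id (Primrec.const (0, 0))

theorem IsUniformBernoulliTest.dominatedBy {t : Omega × I → ℝ≥0∞}
    (ht : IsUniformBernoulliTest t) : DominatedBy t universalTest := by
  obtain ⟨⟨W, hW, hWt⟩, hInt⟩ := ht
  rw [rePredIn_empty] at hW
  have hWt' : ∀ (r : ℕ) (z : Omega × I), (r : ℝ≥0∞) < t z ↔
      ∃ a, W ((r, 0, 0), a) ∧ z ∈ rectangle a := by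
    intro r z
    have := Set.ext_iff.1 (hWt (r, 0, 0)) z
    simp only [Set.mem_ofPred_eq] at this
    rw [← this, coe_natCode_lt_iff]
  -- The closed interval of the piece is placed strictly inside an enumerated rectangle, so that `t`
  -- exceeds the piece's value at the endpoints as well.
  let S : Piece → Prop := fun e => ∃ uv : RatCode × RatCode,
    W ((e.1, 0, 0), (e.2.1, uv)) ∧ ratOf uv.1 < ratOf (leftCode e.2.2.1 e.2.2.2) ∧
      ratOf (rightCode e.2.2.1 e.2.2.2) < ratOf uv.2
  have hS : REPred S := by
    refine REPred.exists (REPred.and (hW.comp (Primrec.to_comp ?_))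
      (PrimrecPred.rePred (PrimrecPred.and ?_ ?_)))
    · exact Primrec.pair (primrec_natCode.comp (Primrec.fst.comp Primrec.fst))
        (Primrec.pair (Primrec.fst.comp (Primrec.snd.comp Primrec.fst)) Primrec.snd)
    · exact primrec_ratOf_lt.comp (Primrec.fst.comp Primrec.snd)
        (primrec_leftCode.comp
          (Primrec.fst.comp (Primrec.snd.comp (Primrec.snd.comp Primrec.fst)))
          (Primrec.snd.comp (Primrec.snd.comp (Primrec.snd.comp Primrec.fst))))
    · exact primrec_ratOf_lt.comp
        (primrec_rightCode.comp
          (Primrec.fst.comp (Primrec.snd.comp (Primrec.snd.comp Primrec.fst)))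
          (Primrec.snd.comp (Primrec.snd.comp (Primrec.snd.comp Primrec.fst))))
        (Primrec.snd.comp Primrec.snd)
  obtain ⟨C, hC⟩ := exists_le_mul_universalTest hS
  refine ⟨C + 2, fun z => le_mul_of_forall_natCast (inv_two_le_universalTest z) fun r hr => ?_⟩
  obtain ⟨⟨x, u, v⟩, ha, hx, hu, hv⟩ := (hWt' r z).1 hr
  obtain ⟨m, hm⟩ := (eventually_dyadic_subset hu hv).exists
  obtain ⟨j, hj⟩ := exists_mem_dyadicOpen z.2 m
  have hsub := hm j (dyadicOpen_subset_dyadicClosed _ _ hj)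
  refine hC z.2 (fun ω => t (ω, z.2)) (hInt z.2) ?_ z.1 (r, x, m, j)
    ⟨(u, v), ha, by exact_mod_cast hsub.1, by exact_mod_cast hsub.2⟩ hj hx
  rintro ω e ⟨uv, hWe, h1, h2⟩ hp hω
  rw [mem_dyadicClosed_iff] at hp
  exact ((hWt' e.1 (ω, z.2)).2 ⟨_, hWe, hω, lt_of_lt_of_le (by exact_mod_cast h1) hp.1,
    lt_of_le_of_lt hp.2 (by exact_mod_cast h2)⟩).le

theorem isUniversal_universalTest : IsUniversal IsUniformBernoulliTest universalTest :=
  ⟨isUniformBernoulliTest_universalTest, fun _ ht => ht.dominatedBy⟩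

end Uniform

/-! ### The infimum over the parameter -/

section Infimum

theorem IsBernoulliTest.isUniformBernoulliTest {t : Omega → ℝ≥0∞} (ht : IsBernoulliTest t) :
    IsUniformBernoulliTest fun z => t z.1 := by
  obtain ⟨⟨W, hW, hWt⟩, hInt⟩ := ht
  refine ⟨⟨fun q => W (q.1, q.2.1) ∧ q.2.2 = ((0, 1, 0), (2, 0, 0)), ?_, fun r => ?_⟩, hInt⟩
  · rw [rePredIn_empty] at hW ⊢
    refine REPred.and (hW.comp (Primrec.to_comp ?_)) (PrimrecPred.rePred ?_)
    · exact Primrec.pair Primrec.fst (Primrec.fst.comp Primrec.snd)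
    · exact Primrec.eq.comp (Primrec.snd.comp Primrec.snd) (Primrec.const _)
  · ext z
    have := Set.ext_iff.1 (hWt r) z.1
    simp only [Set.mem_ofPred_eq] at this ⊢
    rw [this]
    constructor
    · rintro ⟨x, hx, hz⟩
      refine ⟨(x, (0, 1, 0), (2, 0, 0)), ⟨hx, rfl⟩, hz, ?_, ?_⟩
      · have := z.2.2.1
        norm_num [ratOf]; linarith
      · have := z.2.2.2
        norm_num [ratOf]; linarith
    · rintro ⟨a, ⟨ha, -⟩, hz⟩
      exact ⟨a.1, ha, hz.1⟩

/-- With a Lebesgue number `δ` of the cover of `[0,1]` and `(1 / 2) ^ N < δ`, each grid interval of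
level `N` fits into one rectangle. Only finitely many words are involved, so one prefix of `ω`
extends them all. -/
theorem exists_grid_cover {A : Set (List Bool × RatCode × RatCode)} {ω : Omega}
    (hA : ∀ p : I, ∃ a ∈ A, (ω, p) ∈ rectangle a) :
    ∃ M N, ∀ k < 2 ^ N + 1, ∃ a ∈ A, a.1 <+: digitPrefix ω M ∧
      ratOf a.2.1 < ratOf (leftCode N k) ∧ ratOf (rightCode N k) < ratOf a.2.2 := by
  obtain ⟨δ, hδ, hcov⟩ := lebesgue_number_lemma_of_metric (s := Set.Icc (0 : ℝ) 1)
    (c := fun a : {a // a ∈ A ∧ ω ∈ wordCylinder a.1} =>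
      Set.Ioo (ratOf a.1.2.1 : ℝ) (ratOf a.1.2.2)) isCompact_Icc (fun _ => isOpen_Ioo) (by
      intro p hp
      obtain ⟨a, ha, h1, h2⟩ := hA ⟨p, hp⟩
      exact Set.mem_iUnion.2 ⟨⟨a, ha, h1⟩, h2⟩)
  obtain ⟨N, hN⟩ := exists_pow_lt_of_lt_one hδ (show (1 / 2 : ℝ) < 1 by norm_num)
  have hpos : (0 : ℝ) < 2 ^ N := by positivity
  have hN' : (1 : ℝ) / 2 ^ N < δ := by rwa [one_div_pow] at hN
  have hk : ∀ k < 2 ^ N + 1, ∃ a ∈ A, ω ∈ wordCylinder a.1 ∧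
      ratOf a.2.1 < ratOf (leftCode N k) ∧ ratOf (rightCode N k) < ratOf a.2.2 := by
    intro k hk
    have hkle : (k : ℝ) ≤ 2 ^ N := by exact_mod_cast Nat.lt_succ_iff.1 hk
    obtain ⟨⟨a, ha, hω⟩, hball⟩ := hcov ((k : ℝ) / 2 ^ N)
      ⟨by positivity, (div_le_one hpos).2 hkle⟩
    refine ⟨a, ha, hω, ?_, ?_⟩
    · have : (ratOf (leftCode N k) : ℝ) ∈ Metric.ball ((k : ℝ) / 2 ^ N) δ := by
        rw [ratOf_leftCode, Metric.mem_ball, Real.dist_eq, sub_div, sub_sub_cancel_left, abs_neg,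
          abs_of_pos (by positivity)]
        exact hN'
      exact_mod_cast (hball this).1
    · have : (ratOf (rightCode N k) : ℝ) ∈ Metric.ball ((k : ℝ) / 2 ^ N) δ := by
        rw [ratOf_rightCode, Metric.mem_ball, Real.dist_eq, add_div, add_sub_cancel_left,
          abs_of_pos (by positivity)]
        exact hN'
      exact_mod_cast (hball this).2
  choose! f hf using hk
  refine ⟨(Finset.range (2 ^ N + 1)).sup fun k => (f k).1.length, N, fun k hk => ?_⟩
  refine ⟨f k, (hf k hk).1, prefix_digitPrefix_iff.2 ⟨?_, (hf k hk).2.1⟩, (hf k hk).2.2⟩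
  exact Finset.le_sup (f := fun k => (f k).1.length) (Finset.mem_range.2 hk)

theorem primrec_isPrefix : PrimrecRel fun x y : List Bool => x <+: y :=
  (Primrec.eq.comp Primrec.fst (Primrec.list_take.comp (Primrec.list_length.comp Primrec.fst)
    Primrec.snd)).of_eq fun _ => List.prefix_iff_eq_take.symm

theorem IsUniformBernoulliTest.isBernoulliTest_iInf {t : Omega × I → ℝ≥0∞}
    (ht : IsUniformBernoulliTest t) : IsBernoulliTest fun ω => ⨅ p : I, t (ω, p) := by
  obtain ⟨⟨W, hW, hWt⟩, hInt⟩ := ht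
  refine ⟨?_, fun p => (lintegral_mono fun ω => iInf_le _ p).trans (hInt p)⟩
  rw [rePredIn_empty] at hW
  -- A certificate is a rational above the given one together with a grid level: finitely many
  -- rectangles show that `t` exceeds this larger rational for every `p`. The strict gap survives
  -- the passage to the infimum.
  refine ⟨fun q => ∃ w : RatCode × ℕ, ratOf q.1 < ratOf w.1 ∧ ∀ k < 2 ^ w.2 + 1,
    ∃ a : List Bool × RatCode × RatCode, W (w.1, a) ∧ a.1 <+: q.2 ∧
      ratOf a.2.1 < ratOf (leftCode w.2 k) ∧ ratOf (rightCode w.2 k) < ratOf a.2.2, ?_, fun r => ?_⟩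
  · rw [rePredIn_empty]
    refine REPred.exists (REPred.and (PrimrecPred.rePred ?_) ?_)
    · exact primrec_ratOf_lt.comp (Primrec.fst.comp Primrec.fst) (Primrec.fst.comp Primrec.snd)
    · refine REPred.forall_lt (REPred.exists ?_)
        (Primrec.succ.comp (primrec_pow.comp (Primrec.const 2) (Primrec.snd.comp Primrec.snd)))
      have hN : Primrec fun q : (((RatCode × List Bool) × RatCode × ℕ) × ℕ) ×
          List Bool × RatCode × RatCode => q.1.1.2.2 :=
        Primrec.snd.comp (Primrec.snd.comp (Primrec.fst.comp Primrec.fst))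
      have hk : Primrec fun q : (((RatCode × List Bool) × RatCode × ℕ) × ℕ) ×
          List Bool × RatCode × RatCode => q.1.2 := Primrec.snd.comp Primrec.fst
      refine REPred.and (hW.comp (Primrec.to_comp ?_)) (PrimrecPred.rePred
        (PrimrecPred.and ?_ (PrimrecPred.and ?_ ?_)))
      · exact Primrec.pair (Primrec.fst.comp (Primrec.snd.comp (Primrec.fst.comp Primrec.fst)))
          Primrec.snd
      · exact primrec_isPrefix.comp (Primrec.fst.comp Primrec.snd)
          (Primrec.snd.comp (Primrec.fst.comp (Primrec.fst.comp Primrec.fst)))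
      · exact primrec_ratOf_lt.comp (Primrec.fst.comp (Primrec.snd.comp Primrec.snd))
          (primrec_leftCode.comp hN hk)
      · exact primrec_ratOf_lt.comp (primrec_rightCode.comp hN hk)
          (Primrec.snd.comp (Primrec.snd.comp Primrec.snd))
  · ext ω
    simp only [Set.mem_ofPred_eq]
    have hlt : ∀ (r : RatCode) (p : I), ((ratOf r : ℝ) : EReal) < (t (ω, p) : EReal) ↔
        ∃ a, W (r, a) ∧ (ω, p) ∈ rectangle a := fun r p => Set.ext_iff.1 (hWt r) (ω, p)
    constructor
    · intro h
      obtain ⟨q, hq1, hq2⟩ := EReal.lt_iff_exists_rat_btwn.1 h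
      obtain ⟨r', rfl⟩ := exists_ratOf_eq q
      have hcov : ∀ p : I, ∃ a ∈ {a | W (r', a)}, (ω, p) ∈ rectangle a := fun p =>
        (hlt r' p).1 (lt_of_lt_of_le hq2 (EReal.coe_ennreal_le_coe_ennreal_iff.2 (iInf_le _ p)))
      obtain ⟨M, N, hMN⟩ := exists_grid_cover hcov
      refine ⟨digitPrefix ω M, ⟨(r', N), ?_, hMN⟩, mem_wordCylinder_digitPrefix ω M⟩
      exact_mod_cast hq1
    · rintro ⟨x, ⟨⟨r', N⟩, hr, hk⟩, hω⟩
      have hall : ∀ p : I, ((ratOf r' : ℝ) : EReal) < (t (ω, p) : EReal) := by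
        intro p
        obtain ⟨j, hj⟩ := exists_mem_dyadicOpen p N
        have hjN : j < 2 ^ N + 1 := by
          have h1 := hj.1
          have : (p : ℝ) * 2 ^ N ≤ 2 ^ N := mul_le_of_le_one_left (by positivity) p.2.2
          have : (j : ℝ) < 2 ^ N + 1 := by linarith
          exact_mod_cast this
        obtain ⟨a, ha, hx, h1, h2⟩ := hk j hjN
        rw [mem_dyadicOpen_iff] at hj
        exact (hlt r' p).2 ⟨a, ha, mem_wordCylinder_of_isPrefix hx hω,
          lt_trans (by exact_mod_cast h1) hj.1, lt_trans hj.2 (by exact_mod_cast h2)⟩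
      have hrr : (ratOf r : ℝ) < ratOf r' := by exact_mod_cast hr
      rw [coe_lt_coe_ennreal_iff]
      rcases lt_or_ge (ratOf r : ℝ) 0 with h0 | h0
      · exact .inl h0
      · refine .inr (lt_of_lt_of_le
          ((ENNReal.ofReal_lt_ofReal_iff (h0.trans_lt hrr)).2 hrr) (le_iInf fun p => ?_))
        rcases coe_lt_coe_ennreal_iff.1 (hall p) with h | h
        · linarith
        · exact h.le

/-- A Bernoulli test does not depend on `p`, so a bound by `c * t (ω, p)` for all `p` is a bound by
`c` times the infimum. -/
theorem IsUniversal.iInf {t : Omega × I → ℝ≥0∞} (ht : IsUniversal IsUniformBernoulliTest t) :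
    IsUniversal IsBernoulliTest fun ω => ⨅ p : I, t (ω, p) := by
  refine ⟨ht.1.isBernoulliTest_iInf, fun s hs => ?_⟩
  obtain ⟨c, hc⟩ := ht.2 _ hs.isUniformBernoulliTest
  refine ⟨c, fun ω => ?_⟩
  rw [ENNReal.mul_iInf (by simp)]
  exact le_iInf fun p => hc (ω, p)

end Infimum

/-! ### Binary expansions and tests relative to the parameter -/

section Oracle

/-- The natural number with the binary digits `τ`, the most significant first. -/
def binVal (τ : List (Fin 2)) : ℕ := τ.foldl (fun (v : ℕ) (d : Fin 2) => 2 * v + d.val) 0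

theorem binVal_concat (τ : List (Fin 2)) (d : Fin 2) :
    binVal (τ ++ [d]) = 2 * binVal τ + d.val := by
  simp [binVal]

theorem binVal_injective {τ τ' : List (Fin 2)} (hl : τ.length = τ'.length)
    (h : binVal τ = binVal τ') : τ = τ' := by
  induction τ using List.reverseRecOn generalizing τ' with
  | nil => exact (List.length_eq_zero_iff.1 hl.symm).symm
  | append_singleton τ d ih =>
    rcases List.eq_nil_or_concat τ' with rfl | ⟨τ', d', rfl⟩
    · simp at hl
    · rw [List.concat_eq_append] at *
      rw [binVal_concat, binVal_concat] at h
      simp only [List.length_append, List.length_singleton, add_left_inj] at hl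
      have hd : d = d' := by ext; omega
      subst hd
      rw [ih hl (by omega)]

theorem primrec_binVal : Primrec binVal := by
  refine (Primrec.list_foldl (h := fun (_ : List (Fin 2)) (q : ℕ × Fin 2) => 2 * q.1 + q.2.val)
    Primrec.id (Primrec.const 0) ?_).of_eq fun _ => rfl
  exact Primrec.nat_add.comp (Primrec.nat_mul.comp (Primrec.const 2)
    (Primrec.fst.comp Primrec.snd)) (Primrec.fin_val.comp (Primrec.snd.comp Primrec.snd))

/-- A code of the left end of the interval of numbers whose expansions begin with `τ`. -/
def lowerCode (τ : List (Fin 2)) : RatCode := dyadicCode (binVal τ) τ.length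

/-- A code of the right end of the interval of numbers whose expansions begin with `τ`. -/
def upperCode (τ : List (Fin 2)) : RatCode := dyadicCode (binVal τ + 1) τ.length

theorem primrec_lowerCode : Primrec lowerCode :=
  primrec_dyadicCode.comp primrec_binVal Primrec.list_length

theorem primrec_upperCode : Primrec upperCode :=
  primrec_dyadicCode.comp (Primrec.succ.comp primrec_binVal) Primrec.list_length

theorem ratOf_lowerCode (τ : List (Fin 2)) :
    (ratOf (lowerCode τ) : ℝ) = binVal τ / 2 ^ τ.length := ratOf_dyadicCode _ _

theorem ratOf_upperCode (τ : List (Fin 2)) :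
    (ratOf (upperCode τ) : ℝ) = (binVal τ + 1) / 2 ^ τ.length := by
  rw [upperCode, ratOf_dyadicCode]; simp

theorem ratOf_lowerCode_digitPrefix (b : ℕ → Fin 2) (n : ℕ) :
    (ratOf (lowerCode (digitPrefix b n)) : ℝ) =
      ∑ i ∈ Finset.range n, Real.ofDigitsTerm b i := by
  rw [ratOf_lowerCode, length_digitPrefix]
  induction n with
  | zero => simp [digitPrefix, binVal]
  | succ n ih =>
    rw [Finset.sum_range_succ, ← ih, digitPrefix_succ, binVal_concat, Real.ofDigitsTerm]
    push_cast
    rw [pow_succ]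
    field_simp

variable {p : I} {b : ℕ → Fin 2}

theorem ratOf_upperCode_eq_add (b : ℕ → Fin 2) (n : ℕ) :
    (ratOf (upperCode (digitPrefix b n)) : ℝ) =
      ratOf (lowerCode (digitPrefix b n)) + ((2 : ℝ) ^ n)⁻¹ := by
  rw [ratOf_lowerCode, ratOf_upperCode, length_digitPrefix, add_div, one_div]

theorem IsBinaryExpansion.lower_le (h : IsBinaryExpansion p b) (n : ℕ) :
    (ratOf (lowerCode (digitPrefix b n)) : ℝ) ≤ p := by
  rw [ratOf_lowerCode_digitPrefix, ← show Real.ofDigits b = p from h,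
    Real.ofDigits_eq_sum_add_ofDigits b n]
  have := Real.ofDigits_nonneg fun i => b (i + n)
  have : 0 ≤ (((2 : ℕ) : ℝ) ^ n)⁻¹ * Real.ofDigits fun i => b (i + n) := by positivity
  linarith

theorem IsBinaryExpansion.le_upper (h : IsBinaryExpansion p b) (n : ℕ) :
    (p : ℝ) ≤ ratOf (upperCode (digitPrefix b n)) := by
  rw [ratOf_upperCode_eq_add, ratOf_lowerCode_digitPrefix, ← show Real.ofDigits b = p from h,
    Real.ofDigits_eq_sum_add_ofDigits b n]
  have h1 := Real.ofDigits_le_one fun i => b (i + n)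
  have : (((2 : ℕ) : ℝ) ^ n)⁻¹ * Real.ofDigits (fun i => b (i + n)) ≤ ((2 : ℝ) ^ n)⁻¹ :=
    mul_le_of_le_one_right (by positivity) h1
  linarith

theorem lower_mono (b : ℕ → Fin 2) :
    Monotone fun n => (ratOf (lowerCode (digitPrefix b n)) : ℝ) := by
  refine monotone_nat_of_le_succ fun n => ?_
  rw [ratOf_lowerCode_digitPrefix, ratOf_lowerCode_digitPrefix, Finset.sum_range_succ]
  linarith [Real.ofDigitsTerm_nonneg (digits := b) (n := n)]

theorem upper_antitone (b : ℕ → Fin 2) :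
    Antitone fun n => (ratOf (upperCode (digitPrefix b n)) : ℝ) := by
  refine antitone_nat_of_succ_le fun n => ?_
  rw [ratOf_upperCode_eq_add, ratOf_upperCode_eq_add, ratOf_lowerCode_digitPrefix,
    ratOf_lowerCode_digitPrefix, Finset.sum_range_succ]
  have h := Real.ofDigitsTerm_le (digits := b) (n := n)
  have h2 : ((2 : ℝ) ^ n)⁻¹ = 2 * (2 ^ (n + 1))⁻¹ := by rw [pow_succ]; field_simp
  push_cast at h
  linarith

/-- Some later digit is `1` and lifts `p` off the left end. Symmetrically, a later digit `0` keeps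
it off the right end in `lt_upper`. -/
theorem IsBinaryExpansion.lower_lt (h : IsBinaryExpansion p b)
    (hb : ∀ N d, ∃ n ≥ N, b n ≠ d) (n : ℕ) : (ratOf (lowerCode (digitPrefix b n)) : ℝ) < p := by
  obtain ⟨m, hm, hbm⟩ := hb n 0
  refine lt_of_lt_of_le ?_ (h.lower_le (m + 1))
  refine lt_of_le_of_lt (lower_mono b hm) ?_
  beta_reduce
  rw [ratOf_lowerCode_digitPrefix, ratOf_lowerCode_digitPrefix, Finset.sum_range_succ]
  have h1 : (b m : ℕ) = 1 := by
    have : (b m : ℕ) ≠ 0 := fun h0 => hbm (Fin.ext h0)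
    omega
  have : 0 < Real.ofDigitsTerm b m := by
    rw [Real.ofDigitsTerm, h1]; positivity
  linarith

theorem IsBinaryExpansion.lt_upper (h : IsBinaryExpansion p b)
    (hb : ∀ N d, ∃ n ≥ N, b n ≠ d) (n : ℕ) : (p : ℝ) < ratOf (upperCode (digitPrefix b n)) := by
  obtain ⟨m, hm, hbm⟩ := hb n 1
  refine lt_of_le_of_lt (h.le_upper (m + 1)) ?_
  refine lt_of_lt_of_le ?_ (upper_antitone b hm)
  beta_reduce
  rw [ratOf_upperCode_eq_add, ratOf_upperCode_eq_add, ratOf_lowerCode_digitPrefix,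
    ratOf_lowerCode_digitPrefix, Finset.sum_range_succ]
  have h1 : (b m : ℕ) = 0 := by
    have : (b m : ℕ) ≠ 1 := fun h0 => hbm (Fin.ext h0)
    omega
  have h3 : Real.ofDigitsTerm b m = 0 := by rw [Real.ofDigitsTerm, h1]; simp
  have h2 : ((2 : ℝ) ^ m)⁻¹ = 2 * (2 ^ (m + 1))⁻¹ := by rw [pow_succ]; field_simp
  have h4 : (0 : ℝ) < (2 ^ (m + 1))⁻¹ := by positivity
  rw [h3]
  linarith

/-- Two dyadic intervals of the same level coincide if `p` is interior to one and belongs to the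
closure of the other. -/
theorem IsBinaryExpansion.eq_digitPrefix (h : IsBinaryExpansion p b) {τ : List (Fin 2)}
    (h1 : (ratOf (lowerCode τ) : ℝ) < p) (h2 : (p : ℝ) < ratOf (upperCode τ)) :
    τ = digitPrefix b τ.length := by
  refine binVal_injective (by rw [length_digitPrefix]) ?_
  have h3 := h.lower_le τ.length
  have h4 := h.le_upper τ.length
  rw [ratOf_lowerCode] at h1 h3
  rw [ratOf_upperCode] at h2 h4
  rw [length_digitPrefix] at h3 h4
  have hpos : (0 : ℝ) < 2 ^ τ.length := by positivity
  rw [div_lt_iff₀ hpos] at h1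
  rw [div_le_iff₀ hpos] at h3
  rw [lt_div_iff₀ hpos] at h2
  rw [le_div_iff₀ hpos] at h4
  have h5 : (binVal τ : ℝ) < binVal (digitPrefix b τ.length) + 1 := by linarith
  have h6 : (binVal (digitPrefix b τ.length) : ℝ) < binVal τ + 1 := by linarith
  have h5' : binVal τ < binVal (digitPrefix b τ.length) + 1 := by exact_mod_cast h5
  have h6' : binVal (digitPrefix b τ.length) < binVal τ + 1 := by exact_mod_cast h6
  omega

open Filter in
theorem IsBinaryExpansion.exists_between (h : IsBinaryExpansion p b) {u v : ℝ} (hu : u < p)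
    (hv : (p : ℝ) < v) : ∃ n, u < ratOf (lowerCode (digitPrefix b n)) ∧
      (ratOf (upperCode (digitPrefix b n)) : ℝ) < v := by
  have ht : Tendsto (fun m : ℕ => ((2 : ℝ) ^ m)⁻¹) atTop (nhds 0) :=
    tendsto_inv_atTop_zero.comp (tendsto_pow_atTop_atTop_of_one_lt (one_lt_two (α := ℝ)))
  obtain ⟨n, h1, h2⟩ := ((ht.eventually (gt_mem_nhds (sub_pos.2 hu))).and
    (ht.eventually (gt_mem_nhds (sub_pos.2 hv)))).exists
  have h3 := h.lower_le n
  have h4 := h.le_upper n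
  have h5 := ratOf_upperCode_eq_add b n
  exact ⟨n, by linarith, by linarith⟩

theorem REPredIn.rePred_of_eventually_const {α : Type} [Primcodable α] {P : α → Prop}
    (hP : REPredIn (digitOracle b) P) {N : ℕ} {d : Fin 2} (hb : ∀ n ≥ N, b n = d) : REPred P := by
  refine RecursiveIn.partrec_of_oracle ?_ hP
  rintro g rfl
  -- The oracle is a finite table with default value `d`, hence computable.
  have h : Primrec fun n => (((digitPrefix b N)[n]?.getD d : Fin 2) : ℕ) :=
    Primrec.fin_val.comp (Primrec.option_getD.comp (Primrec.list_getElem?₁ _) (Primrec.const d))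
  refine h.to_comp.partrec.of_eq fun n => ?_
  change Part.some (((digitPrefix b N)[n]?.getD d : Fin 2) : ℕ) = _
  rw [getElem?_digitPrefix]
  split_ifs with hn
  · rfl
  · rw [Option.getD_none, hb n (not_lt.1 hn)]

/-- A predicate enumerable with the oracle `b` is enumerable uniformly from the neighborhoods of
the number `p` with the expansion `b`. -/
theorem REPredIn.exists_dyadic {α : Type} [Primcodable α] {P : α → Prop}
    (hb : IsBinaryExpansion p b) (hP : REPredIn (digitOracle b) P) :
    ∃ S : α × ℕ × ℕ → Prop, REPred S ∧
      (∀ a n k, S (a, n, k) → (p : ℝ) ∈ dyadicClosed n k → P a) ∧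
      ∀ a, P a → ∃ n k, (p : ℝ) ∈ dyadicOpen n k ∧ S (a, n, k) := by
  -- For an eventually constant `b`, `p` may be an endpoint of its prefix intervals, so that no
  -- neighborhood reveals the digits; but then the oracle is computable and `S` may ignore the
  -- neighborhood.
  by_cases hconst : ∃ N d, ∀ n ≥ N, b n = d
  · obtain ⟨N, d, hd⟩ := hconst
    refine ⟨fun q => P q.1, (hP.rePred_of_eventually_const hd).comp Computable.fst,
      fun a n k h _ => h, fun a h => ?_⟩
    obtain ⟨k, hk⟩ := exists_mem_dyadicOpen p 0
    exact ⟨0, k, hk, h⟩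
  push Not at hconst
  obtain ⟨V, hV, hPV⟩ := hP.exists_initialSegment
  -- Here `p` is interior to all its prefix intervals, so a small neighborhood lying strictly inside
  -- the interval of `τ` certifies that `τ` is a prefix of `b`.
  refine ⟨fun q => ∃ τ, V (τ, q.1) ∧ ratOf (lowerCode τ) < ratOf (leftCode q.2.1 q.2.2) ∧
    ratOf (rightCode q.2.1 q.2.2) < ratOf (upperCode τ), ?_, ?_, ?_⟩
  · refine REPred.exists (REPred.and (hV.comp (Primrec.to_comp ?_))
      (PrimrecPred.rePred (PrimrecPred.and ?_ ?_)))
    · exact Primrec.pair Primrec.snd (Primrec.fst.comp Primrec.fst)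
    · exact primrec_ratOf_lt.comp (primrec_lowerCode.comp Primrec.snd)
        (primrec_leftCode.comp (Primrec.fst.comp (Primrec.snd.comp Primrec.fst))
          (Primrec.snd.comp (Primrec.snd.comp Primrec.fst)))
    · exact primrec_ratOf_lt.comp
        (primrec_rightCode.comp (Primrec.fst.comp (Primrec.snd.comp Primrec.fst))
          (Primrec.snd.comp (Primrec.snd.comp Primrec.fst)))
        (primrec_upperCode.comp Primrec.snd)
  · rintro a n k ⟨τ, hτ, h1, h2⟩ hp
    rw [mem_dyadicClosed_iff] at hp
    have heq := hb.eq_digitPrefix (τ := τ) (lt_of_lt_of_le (by exact_mod_cast h1) hp.1)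
      (lt_of_le_of_lt hp.2 (by exact_mod_cast h2))
    rw [heq] at hτ
    exact (hPV a).2 ⟨_, hτ⟩
  · intro a ha
    obtain ⟨l, hl⟩ := (hPV a).1 ha
    obtain ⟨n, hn⟩ := (eventually_dyadic_subset (hb.lower_lt hconst l)
      (hb.lt_upper hconst l)).exists
    obtain ⟨k, hk⟩ := exists_mem_dyadicOpen p n
    have hsub := hn k (dyadicOpen_subset_dyadicClosed _ _ hk)
    exact ⟨n, k, hk, _, hl, by exact_mod_cast hsub.1, by exact_mod_cast hsub.2⟩

/-- The pieces read off from `s` may violate the integral bound at parameters other than `p`;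
trimming repairs this without loss at `p`. -/
theorem IsTest.dominatedBy (hb : IsBinaryExpansion p b) {s : Omega → ℝ≥0∞}
    (hs : IsTest (digitOracle b) (bernoulliProd p) s) :
    DominatedBy s fun ω => universalTest (ω, p) := by
  obtain ⟨⟨W, hW, hWs⟩, hInt⟩ := hs
  have hWs' : ∀ (r : ℕ) (ω : Omega), (r : ℝ≥0∞) < s ω ↔
      ∃ x, W ((r, 0, 0), x) ∧ ω ∈ wordCylinder x := by
    intro r ω
    have := Set.ext_iff.1 (hWs (r, 0, 0)) ω
    simp only [Set.mem_ofPred_eq] at this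
    rw [← this, coe_natCode_lt_iff]
  obtain ⟨S, hS, hS1, hS2⟩ := hW.exists_dyadic hb
  have hS' : REPred fun e : Piece => S (((e.1, 0, 0), e.2.1), e.2.2) := by
    refine hS.comp (Primrec.to_comp ?_)
    exact Primrec.pair (Primrec.pair (primrec_natCode.comp Primrec.fst)
      (Primrec.fst.comp Primrec.snd)) (Primrec.snd.comp Primrec.snd)
  obtain ⟨C, hC⟩ := exists_le_mul_universalTest hS'
  refine ⟨C + 2, fun ω => le_mul_of_forall_natCast (inv_two_le_universalTest _) fun r hr => ?_⟩
  obtain ⟨x, hx, hω⟩ := (hWs' r ω).1 hr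
  obtain ⟨n, k, hk, hSx⟩ := hS2 _ hx
  refine hC p s hInt ?_ ω (r, x, n, k) hSx hk hω
  intro ω e he hp hω
  exact ((hWs' e.1 ω).2 ⟨_, hS1 _ _ _ he hp, hω⟩).le

/-- The prefix intervals of `b` are closed, contain `p` and shrink to it, so the oracle eventually
confirms each rational interval around `p`. -/
theorem IsUniformBernoulliTest.isTest {t : Omega × I → ℝ≥0∞} (ht : IsUniformBernoulliTest t)
    (hb : IsBinaryExpansion p b) :
    IsTest (digitOracle b) (bernoulliProd p) fun ω => t (ω, p) := by
  obtain ⟨⟨W, hW, hWt⟩, hInt⟩ := ht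
  rw [rePredIn_empty] at hW
  refine ⟨?_, hInt p⟩
  let V : List (Fin 2) × RatCode × List Bool → Prop := fun q => ∃ uv : RatCode × RatCode,
    W (q.2.1, (q.2.2, uv)) ∧ ratOf uv.1 < ratOf (lowerCode q.1) ∧
      ratOf (upperCode q.1) < ratOf uv.2
  have hV : REPred V := by
    refine REPred.exists (REPred.and (hW.comp (Primrec.to_comp ?_))
      (PrimrecPred.rePred (PrimrecPred.and ?_ ?_)))
    · exact Primrec.pair (Primrec.fst.comp (Primrec.snd.comp Primrec.fst))
        (Primrec.pair (Primrec.snd.comp (Primrec.snd.comp Primrec.fst)) Primrec.snd)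
    · exact primrec_ratOf_lt.comp (Primrec.fst.comp Primrec.snd)
        (primrec_lowerCode.comp (Primrec.fst.comp Primrec.fst))
    · exact primrec_ratOf_lt.comp (primrec_upperCode.comp (Primrec.fst.comp Primrec.fst))
        (Primrec.snd.comp Primrec.snd)
  refine ⟨_, REPred.exists_digitPrefix hV, fun r => ?_⟩
  ext ω
  refine (Set.ext_iff.1 (hWt r) (ω, p)).trans ?_
  constructor
  · rintro ⟨⟨x, u, v⟩, ha, hω, hu, hv⟩
    obtain ⟨n, h1, h2⟩ := hb.exists_between hu hv
    exact ⟨x, ⟨n, (u, v), ha, by exact_mod_cast h1, by exact_mod_cast h2⟩, hω⟩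
  · rintro ⟨x, ⟨n, uv, ha, h1, h2⟩, hω⟩
    exact ⟨(x, uv), ha, hω, lt_of_lt_of_le (by exact_mod_cast h1) (hb.lower_le n),
      lt_of_le_of_lt (hb.le_upper n) (by exact_mod_cast h2)⟩

theorem IsUniversal.slice {t : Omega × I → ℝ≥0∞} (ht : IsUniversal IsUniformBernoulliTest t)
    (hb : IsBinaryExpansion p b) :
    IsUniversal (IsTest (digitOracle b) (bernoulliProd p)) fun ω => t (ω, p) := by
  refine ⟨ht.1.isTest hb, fun s hs => (hs.dominatedBy hb).trans ?_⟩
  obtain ⟨c, hc⟩ := ht.2 _ isUniformBernoulliTest_universalTest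
  exact ⟨c, fun ω => hc (ω, p)⟩

/-! ### Martin-Löf tests and tests of bounded expectation -/

theorem measurableSet_of_uniformlyEffectivelyOpen {ι : Type} [Primcodable ι] {O : Set (ℕ →. ℕ)}
    {U : ι → Set Omega} (hU : UniformlyEffectivelyOpen O wordCylinder U) (i : ι) :
    MeasurableSet (U i) := by
  obtain ⟨W, -, hW⟩ := hU
  have : U i = ⋃ x ∈ {x | W (i, x)}, wordCylinder x := by
    rw [hW]; ext ω; simp
  rw [this]
  exact MeasurableSet.biUnion (Set.to_countable _) fun x _ => measurableSet_wordCylinder x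

theorem IsTest.isMartinLofTest {P : Measure Omega} {t : Omega → ℝ≥0∞}
    (ht : IsTest (digitOracle b) P t) :
    IsMartinLofTest (digitOracle b) P fun i => {ω | (2 : ℝ≥0∞) ^ i < t ω} := by
  obtain ⟨⟨W, hW, hWt⟩, hInt⟩ := ht
  have hopen : UniformlyEffectivelyOpen (digitOracle b) wordCylinder
      fun i : ℕ => {ω | (2 : ℝ≥0∞) ^ i < t ω} := by
    obtain ⟨V, hV, hWV⟩ := hW.exists_initialSegment
    refine ⟨fun q => ∃ k, V (digitPrefix b k, ((2 ^ q.1, 0, 0), q.2)),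
      REPred.exists_digitPrefix (V := fun w : List (Fin 2) × ℕ × List Bool =>
        V (w.1, ((2 ^ w.2.1, 0, 0), w.2.2))) (hV.comp (Primrec.to_comp ?_)), fun i => ?_⟩
    · exact Primrec.pair Primrec.fst (Primrec.pair (primrec_natCode.comp
        (primrec_pow.comp (Primrec.const 2) (Primrec.fst.comp Primrec.snd)))
        (Primrec.snd.comp Primrec.snd))
    · ext ω
      have h := Set.ext_iff.1 (hWt (2 ^ i, 0, 0)) ω
      simp only [Set.mem_ofPred_eq] at h ⊢
      rw [coe_natCode_lt_iff] at h
      push_cast at h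
      rw [h]
      simp only [hWV]
  refine ⟨hopen, fun i => ?_⟩
  have hmeas := measurableSet_of_uniformlyEffectivelyOpen hopen i
  -- Markov's inequality.
  have h1 : (2 : ℝ≥0∞) ^ i * P {ω | (2 : ℝ≥0∞) ^ i < t ω} ≤ 1 := by
    rw [← lintegral_indicator_const hmeas]
    refine (lintegral_mono fun ω => ?_).trans hInt
    refine Set.indicator_apply_le' (fun h => le_of_lt h) fun _ => zero_le
  rw [← ENNReal.inv_pow, ← one_div]
  rw [ENNReal.le_div_iff_mul_le (.inl (by simp)) (.inl (by simp)), mul_comm]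
  exact h1

/-- The test of bounded expectation obtained from a Martin-Löf test. -/
noncomputable def testOfSets (U : ℕ → Set Omega) (ω : Omega) : ℝ≥0∞ :=
  ⨆ i : ℕ, (U (2 * i + 1)).indicator (fun _ => (2 : ℝ≥0∞) ^ i) ω

theorem testOfSets_eq_top {U : ℕ → Set Omega} {ω : Omega} (h : ω ∈ ⋂ i, U i) :
    testOfSets U ω = ∞ := by
  rw [Set.mem_iInter] at h
  refine ENNReal.eq_top_of_forall_nnreal_le fun r => ?_
  obtain ⟨n, hn⟩ := pow_unbounded_of_one_lt r one_lt_two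
  refine le_iSup_of_le n ?_
  rw [Set.indicator_of_mem (h _)]
  exact_mod_cast hn.le

theorem IsMartinLofTest.isTest {P : Measure Omega} {U : ℕ → Set Omega}
    (hU : IsMartinLofTest (digitOracle b) P U) : IsTest (digitOracle b) P (testOfSets U) := by
  obtain ⟨hopen, hP⟩ := hU
  have hmeas := measurableSet_of_uniformlyEffectivelyOpen hopen
  refine ⟨?_, ?_⟩
  · obtain ⟨W, hW, hWU⟩ := hopen
    obtain ⟨V, hV, hWV⟩ := hW.exists_initialSegment
    -- Below level `0` every word is enumerated, since the level set is the whole space.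
    let V' : List (Fin 2) × RatCode × List Bool → Prop := fun q =>
      ratOf q.2.1 < ratOf (0, 0, 0) ∨ ∃ i : ℕ, ratOf q.2.1 < ratOf (2 ^ i, 0, 0) ∧
        V (q.1, (2 * i + 1, q.2.2))
    have hV' : REPred V' := by
      refine REPred.or (PrimrecPred.rePred ?_)
        (REPred.exists (REPred.and (PrimrecPred.rePred ?_) (hV.comp (Primrec.to_comp ?_))))
      · exact primrec_ratOf_lt.comp (Primrec.fst.comp Primrec.snd) (Primrec.const _)
      · exact primrec_ratOf_lt.comp (Primrec.fst.comp (Primrec.snd.comp Primrec.fst))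
          (primrec_natCode.comp (primrec_pow.comp (Primrec.const 2) Primrec.snd))
      · exact Primrec.pair (Primrec.fst.comp Primrec.fst) (Primrec.pair
          (Primrec.nat_double_succ.comp Primrec.snd)
          (Primrec.snd.comp (Primrec.snd.comp Primrec.fst)))
    refine ⟨_, REPred.exists_digitPrefix hV', fun r => ?_⟩
    ext ω
    have hpow : ∀ i : ℕ, ((ratOf r : ℝ) < 0 ∨ ENNReal.ofReal (ratOf r) < (2 : ℝ≥0∞) ^ i) ↔
        ratOf r < ratOf (2 ^ i, 0, 0) := by
      intro i
      have := coe_lt_natCast_mul_iff (r := r) (a := 2 ^ i) (m := 0)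
      rw [coe_lt_coe_ennreal_iff, pow_zero, mul_one] at this
      simpa [dyadicCode] using this
    have hzero : (ratOf r : ℝ) < 0 ↔ ratOf r < ratOf (0, 0, 0) := by
      have : ratOf (0, 0, 0) = 0 := by simp [ratOf]
      rw [this]; exact_mod_cast Iff.rfl
    simp only [Set.mem_ofPred_eq]
    rw [coe_lt_coe_ennreal_iff, testOfSets, lt_iSup_iff]
    constructor
    · rintro (h | ⟨i, hi⟩)
      · exact ⟨[], ⟨0, .inl (hzero.1 h)⟩, fun i => i.elim0⟩
      · have hmem : ω ∈ U (2 * i + 1) := by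
          by_contra hn
          rw [Set.indicator_of_notMem hn] at hi
          exact absurd hi not_lt_zero
        rw [Set.indicator_of_mem hmem] at hi
        rw [hWU] at hmem
        obtain ⟨x, hx, hω⟩ := hmem
        obtain ⟨k, hk⟩ := (hWV _).1 hx
        exact ⟨x, ⟨k, .inr ⟨i, (hpow i).1 (.inr hi), hk⟩⟩, hω⟩
    · rintro ⟨x, ⟨k, h | ⟨i, h1, h2⟩⟩, hω⟩
      · exact .inl (hzero.2 h)
      · have hmem : ω ∈ U (2 * i + 1) := by
          rw [hWU]; exact ⟨x, (hWV _).2 ⟨k, h2⟩, hω⟩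
        rcases (hpow i).2 h1 with h | h
        · exact .inl h
        · exact .inr ⟨i, by rwa [Set.indicator_of_mem hmem]⟩
  -- The indices `2 * i + 1` make the terms `2 ^ i * 2⁻¹ ^ (2 * i + 1)` sum to exactly `1`.
  · calc ∫⁻ ω, testOfSets U ω ∂P
        ≤ ∫⁻ ω, ∑' i : ℕ, (U (2 * i + 1)).indicator (fun _ => (2 : ℝ≥0∞) ^ i) ω ∂P :=
          lintegral_mono fun ω => iSup_le fun i => ENNReal.le_tsum i
      _ = ∑' i : ℕ, (2 : ℝ≥0∞) ^ i * P (U (2 * i + 1)) := by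
          rw [lintegral_tsum fun i => (measurable_const.indicator (hmeas _)).aemeasurable]
          simp only [lintegral_indicator_const (hmeas _)]
      _ ≤ ∑' i : ℕ, 2⁻¹ ^ i * 2⁻¹ := by
          refine ENNReal.tsum_le_tsum fun i => ?_
          calc (2 : ℝ≥0∞) ^ i * P (U (2 * i + 1)) ≤ 2 ^ i * 2⁻¹ ^ (2 * i + 1) := by
                gcongr; exact hP _
            _ = (2 * 2⁻¹) ^ i * (2⁻¹ ^ i * 2⁻¹) := by ring
            _ = 2⁻¹ ^ i * 2⁻¹ := by
                rw [ENNReal.mul_inv_cancel (by norm_num) (by norm_num), one_pow, one_mul]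
      _ = 1 := by
          rw [ENNReal.tsum_mul_right, ENNReal.tsum_geometric, ENNReal.one_sub_inv_two, inv_inv,
            ENNReal.mul_inv_cancel (by norm_num) (by norm_num)]

theorem isMartinLofRandom_iff_isRandom {P : Measure Omega} {ω : Omega} :
    IsMartinLofRandom (digitOracle b) P ω ↔ IsRandom (digitOracle b) P ω := by
  constructor
  · intro h t ht
    have := h _ ht.isMartinLofTest
    by_contra hlt
    rw [not_lt, top_le_iff] at hlt
    refine this (Set.mem_iInter.2 fun i => ?_)
    simp only [Set.mem_ofPred_eq, hlt]
    exact ENNReal.pow_lt_top (by simp)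
  · intro h U hU hω
    exact (h _ hU.isTest).ne (testOfSets_eq_top hω)

end Oracle

/-- An infimum is finite exactly when one of its terms is, and the slice of `universalTest` at `p`
is itself a test with oracle `p` that dominates all the others. -/
theorem lt_top_iff_exists_isRandom {bin : I → ℕ → Fin 2} (hbin : ∀ p, IsBinaryExpansion p (bin p))
    {tB : Omega → ℝ≥0∞} (htB : IsUniversal IsBernoulliTest tB) (ω : Omega) :
    tB ω < ∞ ↔ ∃ p : I, IsRandom (digitOracle (bin p)) (bernoulliProd p) ω := by
  have heq := isUniversal_universalTest.iInf.eqUpToConst htB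
  constructor
  · intro h
    obtain ⟨p, hp⟩ := iInf_lt_iff.1 (heq.1.lt_top h)
    exact ⟨p, fun s hs => (hs.dominatedBy (hbin p)).lt_top hp⟩
  · rintro ⟨p, hp⟩
    exact heq.2.lt_top (iInf_lt_iff.2
      ⟨p, hp _ (isUniformBernoulliTest_universalTest.isTest (hbin p))⟩)

end BernoulliTests

theorem mainTheorem3 :
    -- universal tests of the three kinds exist
    (∃ tB, IsUniversal IsBernoulliTest tB) ∧
    (∃ t, IsUniversal IsUniformBernoulliTest t) ∧
    (∀ (p : I) (b : ℕ → Fin 2), IsBinaryExpansion p b →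
      ∃ s, IsUniversal (IsTest (digitOracle b) (bernoulliProd p)) s) ∧
    -- the universal Bernoulli test is the infimum over `p` of the universal uniform one
    (∀ t tB, IsUniversal IsUniformBernoulliTest t → IsUniversal IsBernoulliTest tB →
      EqUpToConst (fun ω => ⨅ p : I, t (ω, p)) tB) ∧
    -- for fixed `p`, the universal uniform test is the universal `B_p`-test with oracle `p`
    (∀ t, IsUniversal IsUniformBernoulliTest t →
      ∀ (p : I) (b : ℕ → Fin 2), IsBinaryExpansion p b →
        ∀ s, IsUniversal (IsTest (digitOracle b) (bernoulliProd p)) s →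
          EqUpToConst (fun ω => t (ω, p)) s) ∧
    -- Bernoulli sequences are those random for some `B_p` with oracle `p`, in the sense of
    -- Martin-Löf tests and of tests of bounded expectation, whatever expansions serve as oracles
    (∀ bin : I → ℕ → Fin 2, (∀ p, IsBinaryExpansion p (bin p)) →
      ∀ tB, IsUniversal IsBernoulliTest tB → ∀ ω : Omega,
        (tB ω < ∞ ↔ ∃ p : I, IsMartinLofRandom (digitOracle (bin p)) (bernoulliProd p) ω) ∧
        (tB ω < ∞ ↔ ∃ p : I, IsRandom (digitOracle (bin p)) (bernoulliProd p) ω)) := by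

  refine ⟨⟨_, isUniversal_universalTest.iInf⟩, ⟨_, isUniversal_universalTest⟩,
    fun p b hb => ⟨_, isUniversal_universalTest.slice hb⟩,
    fun t tB ht htB => ht.iInf.eqUpToConst htB,
    fun t ht p b hb s hs => (ht.slice hb).eqUpToConst hs,
    fun bin hbin tB htB ω => ⟨?_, lt_top_iff_exists_isRandom hbin htB ω⟩⟩
  rw [lt_top_iff_exists_isRandom hbin htB]
  exact exists_congr fun p => isMartinLofRandom_iff_isRandom.symm
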